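/- Fix a predicate signature that contains a special predicate $\bot$ of arity $0$, and a set of constants. A *database* is a set of facts (ground atoms) that does not contain $\bot$. A *dependency* is a first-order sentence $\forall\vec x\,(\gamma\to\bigvee_{i=1}^m q_i)$, $m\ge 1$, where $\gamma$ is a non-empty finite conjunction of predicate atoms and inequalities $t\neq t'$ between terms (variables or constants), $\vec x$ are the variables of $\gamma$, each of them occurs in a predicate atom of $\gamma$ (the *body*), and each $q_i$ has the form $\exists\vec y_i\,\gamma_i$, with $\gamma_i$ again such a conjunction, the free variables of $q_i$ among $\vec x$, and each variable of $\vec y_i$ occurring in a predicate atom of $\gamma_i$; $\bigvee_i q_i$ is the *head*. Distinct constants denote distinct objects. A finite set $\Sigma$ of dependencies is *acyclic* if the following directed graph on $\Sigma$ has no cycle (including loops): there is an edge from $\tau_1$ to $\tau_2$ iff some predicate occurs both in the head of $\tau_1$ and in the body of $\tau_2$. A database is *consistent* with $\Sigma$ if it satisfies all dependencies of $\Sigma$, and a *repair* of $\langle\Sigma,\mathcal D\rangle$ is a maximal subset of $\mathcal D$ that is consistent with $\Sigma$. Let $\mathrm{Pred}(\Sigma)$ be the set of the predicates that occur in $\Sigma$.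 For each predicate $p$ let $p^*$ be a new predicate of the same arity, and let $\mathrm{aux}$ be the operation that replaces each $p$ by $p^*$ in formulas and in sets of facts. Put $$\Psi^{\mathit{inc}}(\Sigma)=\bigvee_{\tau\in\Sigma}\exists\vec x\,\bigl(\mathrm{aux}(\mathrm{body}(\tau))\wedge\neg\,\mathrm{aux}(\mathrm{head}(\tau))\bigr),$$ where $\vec x$ are the variables of $\mathrm{body}(\tau)$. For a predicate $p$ of arity $m$ and fresh variables $\vec x=x_1,\dots,x_m$, let $\Psi^{\mathit{inc}}(\Sigma,p(\vec x))$ be obtained from $\Psi^{\mathit{inc}}(\Sigma)$ by replacing every atom $p^*(\vec t)$ by $p^*(\vec t)\vee\vec t=\vec x$. Finally put $$\Psi^{\mathit{rc}}(\Sigma)=\neg\Psi^{\mathit{inc}}(\Sigma)\wedge\bigwedge_{p\in\mathrm{Pred}(\Sigma)}\forall\vec x\,\bigl(p(\vec x)\wedge\neg p^*(\vec x)\to\Psi^{\mathit{inc}}(\Sigma,p(\vec x))\bigr).$$ **Theorem.** Let $\Sigma$ be a finite acyclic set of dependencies. 1. For all databases $\mathcal D'\subseteq\mathcal D$: $\mathcal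 D'$ is a repair of $\langle\Sigma,\mathcal D\rangle$ iff $\mathcal D'$ is consistent with $\Sigma$ and, for every $\alpha\in\mathcal D\setminus\mathcal D'$, $\mathcal D'\cup\{\alpha\}$ is inconsistent with $\Sigma$. 2. For all databases $\mathcal D'\subseteq\mathcal D$ over the predicates in $\mathrm{Pred}(\Sigma)$: $\mathcal D\cup\mathrm{aux}(\mathcal D')\models\Psi^{\mathit{rc}}(\Sigma)$ iff $\mathcal D'$ is a repair of $\langle\Sigma,\mathcal D\rangle$. 3. Repair checking for $\Sigma$ is FO-rewritable: there is an FO sentence $\varphi$ such that for all databases $\mathcal D,\mathcal D'$ over $\mathrm{Pred}(\Sigma)$ (whether or not $\mathcal D'\subseteq\mathcal D$), $\mathcal D\cup\mathrm{aux}(\mathcal D')\models\varphi$ iff $\mathcal D'$ is a repair of $\langle\Sigma,\mathcal D\rangle$. 4. Repair checking for $\Sigma$ is in $\mathrm{AC}^0$ in data complexity: for fixed $\Sigma$, the problem of deciding, given finite databases $\mathcal D,\mathcal D'$ over $\mathrm{Pred}(\Sigma)$, whether $\mathcal D'$ is a repair of $\langle\Sigma,\mathcal D\rangle$ is decided by a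 logspace-uniform family of Boolean circuits of polynomial size and constant depth with gates of unbounded fan-in. Here a pair $\mathcal D,\mathcal D'$ is given as a bit string in the standard way: relative to a list, without repetitions, of finitely many constants that begins with the constants of $\Sigma$ in a fixed order and includes all constants of $\mathcal D$ and $\mathcal D'$, there is one bit for each of the two databases, each predicate of $\mathrm{Pred}(\Sigma)\setminus\{\bot\}$ and each tuple of listed constants, which says whether the corresponding fact is in the database. The language of the encodings of the positive instances is in $\mathrm{AC}^0$, and whether an encoding belongs to it depends only on whether $\mathcal D'$ is a repair of $\langle\Sigma,\mathcal D\rangle$, not on the chosen list. -/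

import Mathlib

namespace CQA

open FirstOrder FirstOrder.Language

universe u v

/-! ### Signatures, atoms, dependencies -/

/-- A predicate signature: predicate symbols with arities, among them the special
predicate `⊥` of arity `0`. -/
structure Sig where
  Pred : Type u
  arity : Pred → ℕ
  bot : Pred
  arity_bot : arity bot = 0

/-- Terms: variables (named by natural numbers) and constants from `C`. -/
inductive Tm (C : Type v) where
  | var (x : ℕ) : Tm C
  | cst (c : C) : Tm C

/-- Predicate atoms `p(t₁, …, tₙ)`. -/
structure Atom (S : Sig.{u}) (C : Type v) where
  pred : S.Pred
  args : Fin (S.arity pred) → Tm C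

/-- Facts, i.e. ground atoms. -/
structure Fact (S : Sig.{u}) (C : Type v) where
  pred : S.Pred
  args : Fin (S.arity pred) → C

/-- Conjunctions with inequalities: predicate atoms and inequalities `t ≠ t'`, with at least
one conjunct in total. -/
structure Conj (S : Sig.{u}) (C : Type v) where
  atoms : List (Atom S C)
  ineqs : List (Tm C × Tm C)
  nonempty : atoms ≠ [] ∨ ineqs ≠ []

section Basic

variable {S : Sig.{u}} {C : Type v}

/-- The variables that occur in some predicate atom of the conjunction. -/
def Conj.predVars (γ : Conj S C) : Set ℕ :=
  {x | ∃ a ∈ γ.atoms, ∃ i, a.args i = .var x}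

/-- All variables of the conjunction. -/
def Conj.vars (γ : Conj S C) : Set ℕ :=
  γ.predVars ∪ {x | ∃ e ∈ γ.ineqs, e.1 = .var x ∨ e.2 = .var x}

def Tm.constList : Tm C → List C
  | .var _ => []
  | .cst c => [c]

/-- The constants of the conjunction (possibly with repetitions). -/
def Conj.constList (γ : Conj S C) : List C :=
  (γ.atoms.flatMap fun a => (List.ofFn a.args).flatMap Tm.constList) ++
    γ.ineqs.flatMap fun e => e.1.constList ++ e.2.constList

/-- The predicates of the conjunction (possibly with repetitions). -/
def Conj.predList (γ : Conj S C) : List S.Pred :=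
  γ.atoms.map Atom.pred

end Basic

/-- Conjunctive queries with inequalities `∃ y⃗ γ`; `ex` is the set of the variables `y⃗`, each of
which occurs in `γ`. -/
structure CQ (S : Sig.{u}) (C : Type v) where
  ex : Finset ℕ
  conj : Conj S C
  ex_occurs : (ex : Set ℕ) ⊆ conj.vars

/-- Disjunctive embedded dependencies with inequalities `∀ x⃗ (γ → ⋁ᵢ qᵢ)`, where `x⃗` are the
variables of `γ`. -/
structure Dependency (S : Sig.{u}) (C : Type v) where
  body : Conj S C
  head : List (CQ S C)
  head_ne : head ≠ []
  /-- the body is safe: each of its variables occurs in one of its predicate atoms -/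
  body_safe : body.vars ⊆ body.predVars
  /-- the free variables of the head occur in the body -/
  head_free : ∀ q ∈ head, q.conj.vars \ (q.ex : Set ℕ) ⊆ body.vars
  /-- once its free variables are replaced by constants, the head is safe -/
  head_safe : ∀ q ∈ head, (q.ex : Set ℕ) ⊆ q.conj.predVars

section Basic

variable {S : Sig.{u}} {C : Type v}

def Dependency.constList (τ : Dependency S C) : List C :=
  τ.body.constList ++ τ.head.flatMap fun q => q.conj.constList

def Dependency.predList (τ : Dependency S C) : List S.Pred :=
  τ.body.predList ++ τ.head.flatMap fun q => q.conj.predList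

open scoped Classical in
/-- `Pred(Σ)`: the predicates that occur in `Σ`, listed without repetitions in a fixed order. -/
noncomputable def preds (Sg : Finset (Dependency S C)) : List S.Pred :=
  (Sg.toList.flatMap Dependency.predList).dedup

open scoped Classical in
/-- The constants that occur in `Σ`, listed without repetitions in a fixed order. -/
noncomputable def consts (Sg : Finset (Dependency S C)) : List C :=
  (Sg.toList.flatMap Dependency.constList).dedup

/-- The edges of the dependency graph of `Σ`. -/
def DepEdge (Sg : Finset (Dependency S C)) (τ₁ τ₂ : Dependency S C) : Prop :=
  τ₁ ∈ Sg ∧ τ₂ ∈ Sg ∧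
    ∃ q ∈ τ₁.head, ∃ a ∈ q.conj.atoms, ∃ b ∈ τ₂.body.atoms, a.pred = b.pred

/-- `Σ` is acyclic: its dependency graph has no cyclic path. -/
def Acyclic (Sg : Finset (Dependency S C)) : Prop :=
  ∀ τ, ¬ Relation.TransGen (DepEdge Sg) τ τ

/-- A database is a set of facts that does not contain the fact `⊥`. -/
def IsDatabase (D : Set (Fact S C)) : Prop :=
  ∀ f ∈ D, f.pred ≠ S.bot

/-- A database all of whose predicates occur in `Σ`. -/
def IsDatabaseOver (Sg : Finset (Dependency S C)) (D : Set (Fact S C)) : Prop :=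
  IsDatabase D ∧ ∀ f ∈ D, f.pred ∈ preds Sg

end Basic

/-! ### First-order formulas and their evaluation over sets of facts -/

/-- The only function symbols are the constants. -/
@[reducible] def constFunctions (C : Type v) : ℕ → Type v
  | 0 => C
  | _ + 1 => PEmpty

/-- The first-order language of a signature, with the elements of `C` as constant symbols. -/
@[reducible] def Sig.lang (S : Sig.{u}) (C : Type v) : FirstOrder.Language where
  Functions := constFunctions C
  Relations n := {p : S.Pred // S.arity p = n}

/-- The structure of a set of facts: the universe is the set of all constants, each of
which denotes itself. -/
@[reducible] def Sig.struct (S : Sig.{u}) {C : Type v} (I : Set (Fact S C)) : (S.lang C).Structure C where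
  funMap := fun {n} f _ =>
    match n, f with
    | 0, c => c
    | _ + 1, e => PEmpty.elim e
  RelMap := fun R x => Fact.mk R.1 (fun i => x (Fin.cast R.2 i)) ∈ I

/-- `I ⊨ φ`. -/
def Models {S : Sig.{u}} {C : Type v} (I : Set (Fact S C)) (φ : (S.lang C).Sentence) : Prop :=
  letI := S.struct I
  C ⊨ φ

noncomputable section Formulas

variable {S : Sig.{u}} {C : Type v}

def Tm.toTerm (S : Sig.{u}) : Tm C → (S.lang C).Term ℕ
  | .var x => Term.var x
  | .cst c => Term.func (l := 0) (show constFunctions C 0 from c) Fin.elim0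

/-- The atomic formula `p(t₁, …, tₙ)`. -/
def atomFormula (p : S.Pred) {α : Type} (t : Fin (S.arity p) → (S.lang C).Term α) :
    (S.lang C).Formula α :=
  Relations.formula (L := S.lang C) (n := S.arity p) ⟨p, rfl⟩ t

def bigAnd {L : FirstOrder.Language.{v, u}} {α : Type} (l : List (L.Formula α)) : L.Formula α :=
  l.foldr (· ⊓ ·) ⊤

def bigOr {L : FirstOrder.Language.{v, u}} {α : Type} (l : List (L.Formula α)) : L.Formula α :=
  l.foldr (· ⊔ ·) ⊥

def Conj.toFormula (γ : Conj S C) : (S.lang C).Formula ℕ :=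
  bigAnd (γ.atoms.map fun a => atomFormula a.pred fun i => (a.args i).toTerm S) ⊓
    bigAnd (γ.ineqs.map fun e => ∼((e.1.toTerm S).equal (e.2.toTerm S)))

/-- `∃ y⃗ φ`, where `y⃗` are the variables in `Y`. -/
def exVars {L : FirstOrder.Language.{v, u}} (Y : Finset ℕ) (φ : L.Formula ℕ) : L.Formula ℕ :=
  Formula.iExs Y <| φ.relabel fun x => if h : x ∈ Y then Sum.inr ⟨x, h⟩ else Sum.inl x

def CQ.toFormula (q : CQ S C) : (S.lang C).Formula ℕ :=
  exVars q.ex q.conj.toFormula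

def Dependency.headFormula (τ : Dependency S C) : (S.lang C).Formula ℕ :=
  bigOr (τ.head.map CQ.toFormula)

/-- `∀ x⃗ φ`, where `x⃗` are all the free variables of `φ`. -/
def allClosure {L : FirstOrder.Language.{v, u}} (φ : L.Formula ℕ) : L.Sentence :=
  Formula.iAlls φ.freeVarFinset (Formula.relabel Sum.inr (φ.restrictFreeVar id))

/-- A dependency as a first-order sentence. -/
def Dependency.toSentence (τ : Dependency S C) : (S.lang C).Sentence :=
  allClosure (τ.body.toFormula.imp τ.headFormula)

/-- `D` is consistent with `Σ`. -/
def Consistent (Sg : Finset (Dependency S C)) (D : Set (Fact S C)) : Prop :=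
  ∀ τ ∈ Sg, Models D τ.toSentence

/-- `D'` is a repair of `⟨Σ, D⟩`: a maximal subset of `D` consistent with `Σ`. -/
def IsRepair (Sg : Finset (Dependency S C)) (D D' : Set (Fact S C)) : Prop :=
  Maximal (fun X => X ⊆ D ∧ Consistent Sg X) D'

/-! ### The auxiliary alphabet and the repair checking sentence -/

/-- The signature `S` extended by an auxiliary predicate `p*` (here `Sum.inr p`) of the same arity
for each predicate `p` (here `Sum.inl p`). -/
@[reducible] def Sig.dbl (S : Sig.{u}) : Sig.{u} where
  Pred := S.Pred ⊕ S.Pred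
  arity := Sum.elim S.arity S.arity
  bot := Sum.inl S.bot
  arity_bot := S.arity_bot

/-- The replacement of each predicate atom `p(t)` by `p*(t)`. -/
def auxHom (S : Sig.{u}) (C : Type v) : S.lang C →ᴸ S.dbl.lang C where
  onFunction := fun {_} f => f
  onRelation := fun {_} R => ⟨Sum.inr R.1, R.2⟩

def mainFact (f : Fact S C) : Fact S.dbl C := ⟨Sum.inl f.pred, f.args⟩

def auxFact (f : Fact S C) : Fact S.dbl C := ⟨Sum.inr f.pred, f.args⟩

/-- `D ∪ aux(D')`. -/
def withAux (D D' : Set (Fact S C)) : Set (Fact S.dbl C) :=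
  mainFact '' D ∪ auxFact '' D'

/-- The atom `p(t₁, …, tₙ)` of the extended signature. -/
def mainAtom (p : S.Pred) {α : Type} (t : Fin (S.arity p) → (S.dbl.lang C).Term α) :
    (S.dbl.lang C).Formula α :=
  Relations.formula (L := S.dbl.lang C) (n := S.arity p) ⟨Sum.inl p, rfl⟩ t

/-- The atom `p*(t₁, …, tₙ)` of the extended signature. -/
def auxAtom (p : S.Pred) {α : Type} (t : Fin (S.arity p) → (S.dbl.lang C).Term α) :
    (S.dbl.lang C).Formula α :=
  Relations.formula (L := S.dbl.lang C) (n := S.arity p) ⟨Sum.inr p, rfl⟩ t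

/-- `Ψ^inc(Σ) = ⋁_{τ ∈ Σ} ∃ x⃗ (aux(body(τ)) ∧ ¬ aux(head(τ)))`, where `x⃗` are the variables of
`body(τ)`, which are exactly the free variables of the formula in parentheses. -/
def psiInc (Sg : Finset (Dependency S C)) : (S.dbl.lang C).Sentence :=
  Formula.iSup fun τ : Sg =>
    Formula.exClosure ((auxHom S C).onFormula τ.1.body.toFormula ⊓
      ∼((auxHom S C).onFormula τ.1.headFormula))

/-- A term of a sentence, read as a term of a formula with free variables `x₁, …, xₐ`. -/
def liftTerm {L : FirstOrder.Language.{v, u}} (a : ℕ) {n : ℕ} (t : L.Term (Empty ⊕ Fin n)) :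
    L.Term (Fin a ⊕ Fin n) :=
  t.relabel (Sum.map Empty.elim id)

theorem arity_eq_of_aux {p : S.Pred} {l : ℕ} (R : (S.dbl.lang C).Relations l)
    (h : R.1 = Sum.inr p) : S.arity p = l :=
  (congrArg S.dbl.arity h).symm.trans R.2

open scoped Classical in
/-- The formula in the free variables `x⃗` (as many as the arity of `p`) that results from a sentence
by replacing each atom `p*(t)` by `p*(t) ∨ t = x⃗`. -/
def addAtom (p : S.Pred) {n : ℕ} :
    (S.dbl.lang C).BoundedFormula Empty n →
      (S.dbl.lang C).BoundedFormula (Fin (S.arity p)) n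
  | .falsum => .falsum
  | .equal t₁ t₂ => .equal (liftTerm _ t₁) (liftTerm _ t₂)
  | .rel R ts =>
      if h : R.1 = Sum.inr p then
        .rel R (fun i => liftTerm _ (ts i)) ⊔
          BoundedFormula.iInf fun i : Fin (S.arity p) =>
            (liftTerm _ (ts (Fin.cast (arity_eq_of_aux R h) i))).bdEqual (Term.var (Sum.inl i))
      else .rel R fun i => liftTerm _ (ts i)
  | .imp φ ψ => .imp (addAtom p φ) (addAtom p ψ)
  | .all φ => .all (addAtom p φ)

/-- `Ψ^inc(Σ, p(x⃗))`. -/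
def psiIncAt (Sg : Finset (Dependency S C)) (p : S.Pred) :
    (S.dbl.lang C).Formula (Fin (S.arity p)) :=
  addAtom p (psiInc Sg)

/-- The conjunct `∀ x⃗ (p(x⃗) ∧ ¬ p*(x⃗) → Ψ^inc(Σ, p(x⃗)))` of the repair checking sentence. -/
def psiRcAt (Sg : Finset (Dependency S C)) (p : S.Pred) : (S.dbl.lang C).Sentence :=
  Formula.iAlls (Fin (S.arity p)) <| Formula.relabel Sum.inr <|
    (mainAtom p (fun i => Term.var i) ⊓ ∼(auxAtom p (fun i => Term.var i))).imp (psiIncAt Sg p)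

/-- The repair checking sentence `Ψ^rc(Σ)`. -/
def psiRc (Sg : Finset (Dependency S C)) : (S.dbl.lang C).Sentence :=
  ∼(psiInc Sg) ⊓ bigAnd ((preds Sg).map (psiRcAt Sg))

/-- Repair checking for `Σ` is FO-rewritable: some FO sentence holds in `D ∪ aux(D')` iff `D'` is a
repair of `⟨Σ, D⟩`, for all databases `D` and `D'`. -/
def RepairCheckingFORewritable (Sg : Finset (Dependency S C)) : Prop :=
  ∃ φ : (S.dbl.lang C).Sentence, ∀ D D' : Set (Fact S C),
    IsDatabaseOver Sg D → IsDatabaseOver Sg D' → (Models (withAux D D') φ ↔ IsRepair Sg D D')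

end Formulas

/-! ### Logarithmic space -/

inductive Op where
  | add
  | sub
  | mul
  | div
  | mod

/-- Arithmetic on natural numbers, with truncated subtraction. -/
def Op.eval : Op → ℕ → ℕ → ℕ
  | .add, a, b => a + b
  | .sub, a, b => a - b
  | .mul, a, b => a * b
  | .div, a, b => a / b
  | .mod, a, b => a % b

/-- Programs of a register machine: each program uses finitely many registers, which hold natural
numbers. -/
inductive Prog where
  | const (r k : ℕ) : Prog
  | op (o : Op) (r a b : ℕ) : Prog
  | seq (P Q : Prog) : Prog
  | ifNZ (r : ℕ) (P Q : Prog) : Prog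
  | whileNZ (r : ℕ) (P : Prog) : Prog

/-- `Exec b P s s'`: started in the register contents `s`, the program `P` halts with the register
contents `s'`, and no number written to a register meanwhile has more than `b` binary digits. -/
inductive Exec (b : ℕ) : Prog → (ℕ → ℕ) → (ℕ → ℕ) → Prop
  | const (r k : ℕ) (s : ℕ → ℕ) (h : Nat.size k ≤ b) :
      Exec b (.const r k) s (Function.update s r k)
  | op (o : Op) (r x y : ℕ) (s : ℕ → ℕ) (h : Nat.size (o.eval (s x) (s y)) ≤ b) :
      Exec b (.op o r x y) s (Function.update s r (o.eval (s x) (s y)))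
  | seq {P Q : Prog} {s t w : ℕ → ℕ} (h₁ : Exec b P s t) (h₂ : Exec b Q t w) :
      Exec b (.seq P Q) s w
  | ifTrue {r : ℕ} {P Q : Prog} {s t : ℕ → ℕ} (h : s r ≠ 0) (h₁ : Exec b P s t) :
      Exec b (.ifNZ r P Q) s t
  | ifFalse {r : ℕ} {P Q : Prog} {s t : ℕ → ℕ} (h : s r = 0) (h₁ : Exec b Q s t) :
      Exec b (.ifNZ r P Q) s t
  | whileFalse {r : ℕ} {P : Prog} {s : ℕ → ℕ} (h : s r = 0) : Exec b (.whileNZ r P) s s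
  | whileTrue {r : ℕ} {P : Prog} {s t w : ℕ → ℕ} (h : s r ≠ 0) (h₁ : Exec b P s t)
      (h₂ : Exec b (.whileNZ r P) t w) : Exec b (.whileNZ r P) s w

/-- Started with the inputs in registers `0, 1, …` and `0` in all other registers, the program halts
with the value `y` in register `0`, using at most `b` bits for each number that it writes. -/
def Prog.Computes (P : Prog) (b : ℕ) (inputs : List ℕ) (y : ℕ) : Prop :=
  ∃ s', Exec b P (fun r => inputs.getD r 0) s' ∧ s' 0 = y

/-! ### Circuits and the class AC⁰ -/

inductive GateKind (n : ℕ) where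
  | input (i : Fin n) : GateKind n
  | not : GateKind n
  | and : GateKind n
  | or : GateKind n

def GateKind.code {n : ℕ} : GateKind n → ℕ
  | .and => 0
  | .or => 1
  | .not => 2
  | .input i => i + 3

/-- Boolean circuits with `n` inputs and gates of unbounded fan-in, numbered in a topological order;
`wire g h` says that the output of `h` is an input of `g`. -/
structure Circuit (n : ℕ) where
  size : ℕ
  kind : Fin size → GateKind n
  wire : Fin size → Fin size → Bool
  out : Fin size
  wire_lt : ∀ g h, wire g h = true → h < g
  input_fanin : ∀ g i, kind g = .input i → ∀ h, wire g h = false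
  not_fanin : ∀ g, kind g = .not → ∃! h, wire g h = true

/-- The truth value of a gate on the input `x`. -/
def Circuit.Value {n : ℕ} (K : Circuit n) (x : Fin n → Bool) (g : Fin K.size) : Prop :=
  match K.kind g with
  | .input i => x i = true
  | .not => ∀ h, (_ : K.wire g h = true) → ¬ K.Value x h
  | .and => ∀ h, (_ : K.wire g h = true) → K.Value x h
  | .or => ∃ h, ∃ (_ : K.wire g h = true), K.Value x h
termination_by g.1
decreasing_by all_goals exact K.wire_lt _ _ (by assumption)

def Circuit.Accepts {n : ℕ} (K : Circuit n) (x : Fin n → Bool) : Prop :=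
  K.Value x K.out

/-- The depth is at most `d`: no path along wires is longer than `d`. -/
def Circuit.DepthLE {n : ℕ} (K : Circuit n) (d : ℕ) : Prop :=
  ∀ l : List (Fin K.size), l.IsChain (fun g h => K.wire g h = true) → l.length ≤ d + 1

/-- Logspace uniformity: from `n` (and the numbers of gates), the size of the `n`-th circuit, its
output gate, the kinds of its gates and its wires can be computed in space `O(log n)`. -/
def LogspaceUniform (K : ∀ n, Circuit n) : Prop :=
  ∃ (pSize pOut pKind pWire : Prog) (c : ℕ), ∀ n : ℕ,
    pSize.Computes (c * (Nat.size n + 1)) [n] (K n).size ∧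
    pOut.Computes (c * (Nat.size n + 1)) [n] (K n).out ∧
    (∀ g : Fin (K n).size,
      pKind.Computes (c * (Nat.size n + 1)) [n, g] ((K n).kind g).code) ∧
    ∀ g h : Fin (K n).size,
      pWire.Computes (c * (Nat.size n + 1)) [n, g, h] ((K n).wire g h).toNat

/-- The class AC⁰: languages decided by a logspace-uniform family of circuits of polynomial size and
constant depth, with gates of unbounded fan-in. -/
def InAC0 (L : _root_.Language Bool) : Prop :=
  ∃ (K : ∀ n, Circuit n) (c d : ℕ),
    (∀ n, (K n).size ≤ c * (n + 1) ^ c) ∧ (∀ n, (K n).DepthLE d) ∧ LogspaceUniform K ∧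
      ∀ w : List Bool, w ∈ L ↔ (K w.length).Accepts w.get

/-! ### Repair checking as a decision problem -/

noncomputable section Problem

variable {S : Sig.{u}} {C : Type v}

open scoped Classical in
/-- The predicates that databases over the predicates of `Σ` can use, in a fixed order. -/
def dataPreds (Sg : Finset (Dependency S C)) : List S.Pred :=
  (preds Sg).filter fun p => p ≠ S.bot

open scoped Classical in
/-- The bit array of the relation of `p` in `D`: one bit for each tuple over the constants listed in
`dom`, the tuples being numbered as numerals in base `dom.length`. -/
def encodePred (dom : List C) (D : Set (Fact S C)) (p : S.Pred) : List Bool :=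
  List.ofFn fun k : Fin (dom.length ^ S.arity p) =>
    decide (Fact.mk p (fun i => dom.get (finFunctionFinEquiv.symm k i)) ∈ D)

/-- The bit string of a pair of databases: the arrays of all the relations of `D`, then those
of all the relations of `D'`. -/
def encode (Sg : Finset (Dependency S C)) (dom : List C) (D D' : Set (Fact S C)) : List Bool :=
  (dataPreds Sg).flatMap (encodePred dom D) ++ (dataPreds Sg).flatMap (encodePred dom D')

/-- `D` and `D'` are (finite) databases over the predicates of `Σ`, and `dom` lists without
repetitions the constants of `Σ`, in their fixed order, followed by further constants, among which
are all the others of `D` and `D'`. -/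
structure IsInstance (Sg : Finset (Dependency S C)) (dom : List C) (D D' : Set (Fact S C)) :
    Prop where
  nodup : dom.Nodup
  consts_prefix : consts Sg <+: dom
  database : IsDatabaseOver Sg D
  database' : IsDatabaseOver Sg D'
  adom : ∀ f ∈ D ∪ D', ∀ i, f.args i ∈ dom

/-- The language of the encodings of the pairs `D, D'` for which `D'` is a repair of
`⟨Σ, D⟩`; the set `Σ` is fixed (data complexity). -/
def repairLanguage (Sg : Finset (Dependency S C)) : _root_.Language Bool :=
  {w | ∃ dom D D', IsInstance Sg dom D D' ∧ w = encode Sg dom D D' ∧ IsRepair Sg D D'}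

end Problem

end CQA

namespace CQA

open FirstOrder FirstOrder.Language

universe u v

section Semantics

variable {S : Sig.{u}} {C : Type v}

/-- The value of a term under an assignment of constants to variables. -/
def Tm.val (σ : ℕ → C) : Tm C → C
  | .var x => σ x
  | .cst c => c

/-- The ground instance of an atom under an assignment. -/
def Atom.inst (σ : ℕ → C) (a : Atom S C) : Fact S C := ⟨a.pred, fun i => (a.args i).val σ⟩

/-- The conjunction holds in the set of facts under the assignment. -/
def Conj.Sat (I : Set (Fact S C)) (σ : ℕ → C) (γ : Conj S C) : Prop :=
  (∀ a ∈ γ.atoms, a.inst σ ∈ I) ∧ ∀ e ∈ γ.ineqs, e.1.val σ ≠ e.2.val σ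

def CQ.Sat (I : Set (Fact S C)) (σ : ℕ → C) (q : CQ S C) : Prop :=
  ∃ σ' : ℕ → C, (∀ x ∉ q.ex, σ' x = σ x) ∧ q.conj.Sat I σ'

def Dependency.Sat (I : Set (Fact S C)) (τ : Dependency S C) : Prop :=
  ∀ σ : ℕ → C, τ.body.Sat I σ → ∃ q ∈ τ.head, q.Sat I σ

theorem Conj.Sat.mono {I J : Set (Fact S C)} (h : I ⊆ J) {σ : ℕ → C} {γ : Conj S C}
    (hs : γ.Sat I σ) : γ.Sat J σ :=
  ⟨fun a ha => h (hs.1 a ha), hs.2⟩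

/-! ### Realization of the formulas -/

theorem realize_bigAnd {L : FirstOrder.Language.{v, u}} {M : Type v} [L.Structure M] {α : Type}
    (l : List (L.Formula α)) (w : α → M) :
    (bigAnd l).Realize w ↔ ∀ φ ∈ l, φ.Realize w := by
  induction l with
  | nil => simp [bigAnd, Formula.Realize]
  | cons φ l ih =>
    have : bigAnd (φ :: l) = φ ⊓ bigAnd l := rfl
    simp [this, Formula.realize_inf, ih]

theorem realize_bigOr {L : FirstOrder.Language.{v, u}} {M : Type v} [L.Structure M] {α : Type}
    (l : List (L.Formula α)) (w : α → M) :
    (bigOr l).Realize w ↔ ∃ φ ∈ l, φ.Realize w := by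
  induction l with
  | nil => simp [bigOr, Formula.Realize]
  | cons φ l ih =>
    have : bigOr (φ :: l) = φ ⊔ bigOr l := rfl
    simp [this, Formula.realize_sup, ih]

theorem realize_exVars {L : FirstOrder.Language.{v, u}} {M : Type v} [L.Structure M]
    (Y : Finset ℕ) (φ : L.Formula ℕ) (w : ℕ → M) :
    (exVars Y φ).Realize w ↔ ∃ w' : ℕ → M, (∀ x ∉ Y, w' x = w x) ∧ φ.Realize w' := by
  classical
  rw [exVars, Formula.realize_iExs]
  constructor
  · rintro ⟨i, hi⟩
    refine ⟨fun x => if h : x ∈ Y then i ⟨x, h⟩ else w x, fun x hx => by simp [hx], ?_⟩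
    rw [Formula.realize_relabel] at hi
    convert hi using 1
    funext x
    by_cases h : x ∈ Y <;> simp [h]
  · rintro ⟨w', h₁, h₂⟩
    refine ⟨fun x => w' x, ?_⟩
    rw [Formula.realize_relabel]
    convert h₂ using 1
    funext x
    by_cases h : x ∈ Y <;> simp [h, h₁]

theorem exists_realize_restrict {L : FirstOrder.Language.{v, u}} {M : Type v} [L.Structure M]
    [Nonempty M] (φ : L.Formula ℕ) (w : φ.freeVarFinset → M) :
    ∃ w' : ℕ → M, (Formula.Realize (φ.restrictFreeVar id) w ↔ φ.Realize w') := by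
  classical
  refine ⟨fun x => if h : x ∈ φ.freeVarFinset then w ⟨x, h⟩ else Classical.arbitrary M, ?_⟩
  exact BoundedFormula.realize_restrictFreeVar _ (by simp)

theorem realize_allClosure {L : FirstOrder.Language.{v, u}} {M : Type v} [L.Structure M]
    [Nonempty M] (φ : L.Formula ℕ) :
    M ⊨ allClosure φ ↔ ∀ w : ℕ → M, φ.Realize w := by
  rw [allClosure, Sentence.Realize, Formula.realize_iAlls]
  simp only [Formula.realize_relabel]
  constructor
  · intro h w
    have := h fun x => w x
    exact (BoundedFormula.realize_restrictFreeVar (f := id) w (fun _ => rfl)).1 this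
  · intro h i
    obtain ⟨w', hw'⟩ := exists_realize_restrict φ i
    exact hw'.2 (h w')

theorem realize_exClosure_iff {L : FirstOrder.Language.{v, u}} {M : Type v} [L.Structure M]
    [Nonempty M] (φ : L.Formula ℕ) :
    M ⊨ φ.exClosure ↔ ∃ w : ℕ → M, φ.Realize w := by
  rw [Formula.realize_exClosure]
  constructor
  · rintro ⟨w, hw⟩
    obtain ⟨w', hw'⟩ := exists_realize_restrict φ w
    exact ⟨w', hw'.1 hw⟩
  · rintro ⟨w, hw⟩
    exact ⟨fun x => w x, (BoundedFormula.realize_restrictFreeVar (f := id) w (fun _ => rfl)).2 hw⟩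

theorem realize_toTerm (I : Set (Fact S C)) (t : Tm C) (w : ℕ → C) :
    letI := S.struct I
    (t.toTerm S).realize w = t.val w := by
  cases t <;> rfl

theorem realize_conj (I : Set (Fact S C)) (γ : Conj S C) (w : ℕ → C) :
    letI := S.struct I
    γ.toFormula.Realize w ↔ γ.Sat I w := by
  let := S.struct I
  simp only [Conj.toFormula, Formula.realize_inf, realize_bigAnd, List.forall_mem_map, Conj.Sat,
    Formula.realize_not, Formula.realize_equal, realize_toTerm, atomFormula, Formula.realize_rel]
  rfl

theorem realize_headFormula (I : Set (Fact S C)) (τ : Dependency S C) (w : ℕ → C) :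
    letI := S.struct I
    τ.headFormula.Realize w ↔ ∃ q ∈ τ.head, q.Sat I w := by
  let := S.struct I
  simp only [Dependency.headFormula, realize_bigOr, List.mem_map,
    exists_exists_and_eq_and, CQ.toFormula, realize_exVars, realize_conj, CQ.Sat]

theorem models_toSentence [Nonempty C] (I : Set (Fact S C)) (τ : Dependency S C) :
    Models I τ.toSentence ↔ τ.Sat I := by
  let := S.struct I
  simp only [Models, Dependency.toSentence, realize_allClosure, Formula.realize_imp, realize_conj,
    realize_headFormula, Dependency.Sat]

theorem consistent_iff [Nonempty C] (Sg : Finset (Dependency S C)) (I : Set (Fact S C)) :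
    Consistent Sg I ↔ ∀ τ ∈ Sg, τ.Sat I := by
  simp only [Consistent, models_toSentence]

theorem auxFact_injective : Function.Injective (auxFact (S := S) (C := C)) := by
  rintro ⟨p, x⟩ ⟨q, y⟩ h
  obtain rfl : p = q := Sum.inr_injective (congrArg Fact.pred h)
  exact congrArg (Fact.mk p) (eq_of_heq (Fact.mk.inj h).2)

theorem mainFact_injective : Function.Injective (mainFact (S := S) (C := C)) := by
  rintro ⟨p, x⟩ ⟨q, y⟩ h
  obtain rfl : p = q := Sum.inl_injective (congrArg Fact.pred h)
  exact congrArg (Fact.mk p) (eq_of_heq (Fact.mk.inj h).2)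

theorem auxFact_mem_withAux (D D' : Set (Fact S C)) (f : Fact S C) :
    auxFact f ∈ withAux D D' ↔ f ∈ D' := by
  constructor
  · rintro (⟨g, _, h⟩ | ⟨g, hg, h⟩)
    · cases congrArg Fact.pred h
    · exact auxFact_injective h ▸ hg
  · exact fun h => Or.inr ⟨f, h, rfl⟩

theorem mainFact_mem_withAux (D D' : Set (Fact S C)) (f : Fact S C) :
    mainFact f ∈ withAux D D' ↔ f ∈ D := by
  constructor
  · rintro (⟨g, hg, h⟩ | ⟨g, _, h⟩)
    · exact mainFact_injective h ▸ hg
    · cases congrArg Fact.pred h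
  · exact fun h => Or.inl ⟨f, h, rfl⟩

theorem isExpansionOn_auxHom (D D' : Set (Fact S C)) :
    letI := S.struct D'
    letI := S.dbl.struct (withAux D D')
    (auxHom S C).IsExpansionOn C := by
  let := S.struct D'
  let := S.dbl.struct (withAux D D')
  refine ⟨fun {n} f x => ?_, fun {n} R x => ?_⟩
  · match n, f with
    | 0, f => rfl
    | n + 1, f => exact f.elim
  obtain ⟨p, rfl⟩ := R
  exact propext (auxFact_mem_withAux D D' ⟨p, x⟩)

theorem models_psiInc [Nonempty C] (Sg : Finset (Dependency S C)) (D D' : Set (Fact S C)) :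
    Models (withAux D D') (psiInc Sg) ↔ ¬ Consistent Sg D' := by
  let i1 := S.struct D'
  let i2 := S.dbl.struct (withAux D D')
  have := isExpansionOn_auxHom D D'
  rw [consistent_iff]
  simp only [Models, psiInc, Sentence.Realize, Formula.realize_iSup]
  have key : ∀ τ : Dependency S C, (Formula.exClosure ((auxHom S C).onFormula τ.body.toFormula ⊓
      ∼((auxHom S C).onFormula τ.headFormula))).Realize C ↔ ¬ τ.Sat D' := by
    intro τ
    refine (realize_exClosure_iff _).trans ?_
    simp only [Formula.realize_inf, Formula.realize_not, LHom.realize_onFormula, Dependency.Sat]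
    simp only [realize_conj, realize_headFormula]
    push Not
    rfl
  push Not
  simp only [← key]
  simp [Sentence.Realize]

theorem realize_liftTerm {L : FirstOrder.Language.{v, u}} {M : Type v} [L.Structure M] (a : ℕ)
    {n : ℕ} (t : L.Term (Empty ⊕ Fin n)) (x : Fin a → M) (xs : Fin n → M) :
    (liftTerm a t).realize (Sum.elim x xs) = t.realize (Sum.elim default xs) := by
  rw [liftTerm, Term.realize_relabel]
  congr 1
  funext i
  rcases i with i | i
  · exact i.elim
  · rfl

theorem term_realize_congr (I J : Set (Fact S C)) {α : Type} (t : (S.lang C).Term α) (w : α → C) :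
    @Term.realize _ C (S.struct I) _ w t = @Term.realize _ C (S.struct J) _ w t := by
  induction t with
  | var => rfl
  | @func l f ts ih =>
    match l, f with
    | 0, f => rfl
    | l + 1, f => exact f.elim

theorem realize_addAtom (D D' : Set (Fact S C)) (p : S.Pred) (x : Fin (S.arity p) → C) {n : ℕ}
    (φ : (S.dbl.lang C).BoundedFormula Empty n) (xs : Fin n → C) :
    @BoundedFormula.Realize _ C (S.dbl.struct (withAux D D')) _ _ (addAtom p φ) x xs ↔
      @BoundedFormula.Realize _ C (S.dbl.struct (withAux D (insert ⟨p, x⟩ D'))) _ _ φ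
        default xs := by
  induction φ with
  | falsum => exact Iff.rfl
  | equal t₁ t₂ =>
    let := S.dbl.struct (withAux D D')
    change (liftTerm _ t₁).realize _ = (liftTerm _ t₂).realize _ ↔ _ = _
    rw [realize_liftTerm, realize_liftTerm,
      term_realize_congr (withAux D D') (withAux D (insert ⟨p, x⟩ D')),
      term_realize_congr (withAux D D') (withAux D (insert ⟨p, x⟩ D'))]
  | imp φ ψ ih₁ ih₂ =>
    exact imp_congr (ih₁ xs) (ih₂ xs)
  | all φ ih =>
    exact forall_congr' fun a => ih _
  | @rel n l R ts =>
    let := S.dbl.struct (withAux D D')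
    have hR : @BoundedFormula.Realize _ C (S.dbl.struct (withAux D (insert ⟨p, x⟩ D'))) _ _
        (.rel R ts) default xs ↔ Fact.mk R.1 (fun i => (ts (Fin.cast R.2 i)).realize
          (Sum.elim default xs)) ∈ withAux D (insert ⟨p, x⟩ D') := by
      simp_rw [term_realize_congr (withAux D D') (withAux D (insert ⟨p, x⟩ D'))]
      rfl
    have hL : (BoundedFormula.rel R (fun i => liftTerm (S.arity p) (ts i))).Realize x xs ↔
        Fact.mk R.1 (fun i => (ts (Fin.cast R.2 i)).realize
          (Sum.elim default xs)) ∈ withAux D D' := by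
      simp_rw [← realize_liftTerm (S.arity p) _ x xs]
      rfl
    rw [hR, addAtom]
    obtain ⟨q, rfl⟩ := R
    by_cases h : q = Sum.inr p
    · subst h
      rw [dif_pos rfl, BoundedFormula.realize_sup, BoundedFormula.realize_iInf, hL]
      simp only [BoundedFormula.realize_bdEqual, realize_liftTerm]
      refine (or_congr (auxFact_mem_withAux D D' ⟨p, _⟩) Iff.rfl).trans
        (Iff.trans ?_ (auxFact_mem_withAux D _ ⟨p, _⟩).symm)
      rw [Set.mem_insert_iff, or_comm]
      refine or_congr ?_ Iff.rfl
      exact ⟨fun h => congrArg (Fact.mk p) (funext h),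
        fun h => congrFun (eq_of_heq (Fact.mk.inj h).2)⟩
    · rw [dif_neg h, hL]
      rcases q with q | q
      · exact (mainFact_mem_withAux D D' ⟨q, _⟩).trans (mainFact_mem_withAux D _ ⟨q, _⟩).symm
      · refine (auxFact_mem_withAux D D' ⟨q, _⟩).trans
          (Iff.trans ?_ (auxFact_mem_withAux D _ ⟨q, _⟩).symm)
        rw [Set.mem_insert_iff, or_iff_right]
        intro e
        exact h (congrArg Sum.inr (congrArg Fact.pred e))

theorem models_psiRcAt [Nonempty C] (Sg : Finset (Dependency S C)) (D D' : Set (Fact S C))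
    (p : S.Pred) : Models (withAux D D') (psiRcAt Sg p) ↔
      ∀ x : Fin (S.arity p) → C, Fact.mk p x ∈ D → Fact.mk p x ∉ D' →
        ¬ Consistent Sg (insert ⟨p, x⟩ D') := by
  let := S.dbl.struct (withAux D D')
  simp only [Models, psiRcAt, Sentence.Realize, Formula.realize_iAlls, Formula.realize_relabel,
    Formula.realize_imp, Formula.realize_inf, Formula.realize_not, and_imp]
  refine forall_congr' fun x => ?_
  refine imp_congr (mainFact_mem_withAux D D' ⟨p, x⟩)
    (imp_congr (not_congr (auxFact_mem_withAux D D' ⟨p, x⟩)) ?_)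
  rw [← models_psiInc Sg D]
  exact realize_addAtom D D' p x (psiInc Sg) default

theorem models_psiRc [Nonempty C] (Sg : Finset (Dependency S C)) {D D' : Set (Fact S C)}
    (hD : IsDatabaseOver Sg D) : Models (withAux D D') (psiRc Sg) ↔
      Consistent Sg D' ∧ ∀ α ∈ D \ D', ¬ Consistent Sg (insert α D') := by
  let := S.dbl.struct (withAux D D')
  have hinc := not_congr (models_psiInc Sg D D')
  rw [not_not] at hinc
  rw [← hinc]
  simp only [Models, psiRc, Sentence.Realize, Formula.realize_inf, Formula.realize_not,
    realize_bigAnd, List.forall_mem_map]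
  refine and_congr Iff.rfl ?_
  refine (forall₂_congr fun p _ => models_psiRcAt Sg D D' p).trans ?_
  constructor
  · rintro h ⟨p, x⟩ hα
    exact h p (hD.2 _ hα.1) x hα.1 hα.2
  · exact fun h p _ x h₁ h₂ => h ⟨p, x⟩ ⟨h₁, h₂⟩

/-! ### Repairs and single facts -/

theorem exists_fact_of_head_and_body [Nonempty C] {Sg : Finset (Dependency S C)} {D' E : Set (Fact S C)}
    (hE : Consistent Sg E) (hsub : D' ⊆ E) (hD' : Consistent Sg D') {α : Fact S C}
    (hα : α ∈ E \ D') (hinc : ¬ Consistent Sg (insert α D')) :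
    ∃ τ ∈ Sg, (∃ a ∈ τ.body.atoms, a.pred = α.pred) ∧
      ∃ β ∈ E \ D', ∃ q ∈ τ.head, ∃ a ∈ q.conj.atoms, a.pred = β.pred := by
  rw [consistent_iff] at hE hD' hinc
  have hins : insert α D' ⊆ E := Set.insert_subset hα.1 hsub
  simp only [Dependency.Sat] at hinc
  push Not at hinc
  obtain ⟨τ, hτ, σ, hb, hh⟩ := hinc
  refine ⟨τ, hτ, ?_, ?_⟩
  · by_contra! hne
    have hb' : τ.body.Sat D' σ := by
      refine ⟨fun a ha => (hb.1 a ha).resolve_left fun e => ?_, hb.2⟩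
      exact hne a ha (congrArg Fact.pred e)
    obtain ⟨q, hq, σ', h₁, h₂⟩ := hD' τ hτ σ hb'
    exact hh q hq ⟨σ', h₁, h₂.mono (Set.subset_insert _ _)⟩
  · obtain ⟨q, hq, σ', h₁, h₂⟩ := hE τ hτ σ (hb.mono hins)
    have : ∃ a ∈ q.conj.atoms, a.inst σ' ∉ insert α D' := by
      by_contra! hall
      exact hh q hq ⟨σ', h₁, hall, h₂.2⟩
    obtain ⟨a, ha, hn⟩ := this
    exact ⟨a.inst σ', ⟨h₂.1 a ha, fun h => hn (Set.mem_insert_of_mem _ h)⟩, q, hq, a, ha, rfl⟩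

theorem not_forall_exists_depEdge {Sg : Finset (Dependency S C)} (hSg : Acyclic Sg)
    (P : Dependency S C → Prop) (hP : ∃ τ, P τ)
    (hstep : ∀ τ, P τ → ∃ τ', P τ' ∧ DepEdge Sg τ τ') : False := by
  obtain ⟨τ₀, h₀⟩ := hP
  choose! f hf₁ hf₂ using hstep
  have hPn : ∀ n, P (f^[n] τ₀) := fun n => by
    induction n with
    | zero => exact h₀
    | succ n ih => rw [Function.iterate_succ_apply']; exact hf₁ _ ih
  have hedge : ∀ n, DepEdge Sg (f^[n] τ₀) (f^[n + 1] τ₀) := fun n => by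
    rw [Function.iterate_succ_apply']; exact hf₂ _ (hPn n)
  have htrans : ∀ m n, m < n → Relation.TransGen (DepEdge Sg) (f^[m] τ₀) (f^[n] τ₀) := by
    intro m n h
    induction n, h using Nat.le_induction with
    | base => exact .single (hedge m)
    | succ n _ ih => exact ih.tail (hedge n)
  have hmem : ∀ n, f^[n] τ₀ ∈ (Sg : Set (Dependency S C)) := fun n => (hedge n).1
  obtain ⟨m, n, hmn, he⟩ :=
    Set.Finite.exists_lt_map_eq_of_forall_mem (t := (Sg : Set (Dependency S C)))
      (f := fun n => f^[n] τ₀) hmem (Finset.finite_toSet _)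
  have := htrans m n hmn
  rw [he] at this
  exact hSg _ this

theorem isRepair_iff [Nonempty C] {Sg : Finset (Dependency S C)} (hSg : Acyclic Sg)
    {D D' : Set (Fact S C)} (hsub : D' ⊆ D) :
    IsRepair Sg D D' ↔
      Consistent Sg D' ∧ ∀ α ∈ D \ D', ¬ Consistent Sg (insert α D') := by
  constructor
  · rintro ⟨⟨_, hc⟩, hmax⟩
    refine ⟨hc, fun α hα hcons => hα.2 ?_⟩
    exact hmax ⟨Set.insert_subset hα.1 hsub, hcons⟩ (Set.subset_insert _ _) (Set.mem_insert _ _)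
  · rintro ⟨hc, hmax⟩
    refine ⟨⟨hsub, hc⟩, ?_⟩
    rintro E ⟨hED, hE⟩ hle
    by_contra hne
    obtain ⟨α₀, hα₀, hα₀'⟩ := Set.not_subset.1 hne
    have step : ∀ α ∈ E \ D', _ := fun α hα =>
      exists_fact_of_head_and_body hE hle hc hα (hmax α ⟨hED hα.1, hα.2⟩)
    refine not_forall_exists_depEdge hSg (fun τ => τ ∈ Sg ∧
      ∃ β ∈ E \ D', ∃ q ∈ τ.head, ∃ a ∈ q.conj.atoms, a.pred = β.pred) ?_ ?_
    · obtain ⟨τ, hτ, _, h⟩ := step α₀ ⟨hα₀, hα₀'⟩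
      exact ⟨τ, hτ, h⟩
    · rintro τ ⟨hτ, β, hβ, q, hq, a, ha, hab⟩
      obtain ⟨τ', hτ', ⟨b, hb, hbβ⟩, h⟩ := step β hβ
      exact ⟨τ', ⟨hτ', h⟩, hτ, hτ', q, hq, a, ha, b, hb, hab.trans hbβ.symm⟩

theorem isRepair_iff_subset [Nonempty C] {Sg : Finset (Dependency S C)} (hSg : Acyclic Sg)
    (D D' : Set (Fact S C)) :
    IsRepair Sg D D' ↔
      D' ⊆ D ∧ Consistent Sg D' ∧ ∀ α ∈ D \ D', ¬ Consistent Sg (insert α D') := by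
  by_cases h : D' ⊆ D
  · rw [isRepair_iff hSg h, and_iff_right h]
  · exact iff_of_false (fun hr => h hr.1.1) fun hr => h hr.1

/-- The sentence `∀ x⃗ (p*(x⃗) → p(x⃗))`. -/
noncomputable def auxSubsetAt (C : Type v) (p : S.Pred) : (S.dbl.lang C).Sentence :=
  Formula.iAlls (Fin (S.arity p)) <| Formula.relabel Sum.inr <|
    (auxAtom p (fun i => Term.var i)).imp (mainAtom p (fun i => Term.var i))

theorem models_auxSubsetAt (D D' : Set (Fact S C)) (p : S.Pred) :
    Models (withAux D D') (auxSubsetAt C p) ↔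
      ∀ x : Fin (S.arity p) → C, Fact.mk p x ∈ D' → Fact.mk p x ∈ D := by
  let := S.dbl.struct (withAux D D')
  simp only [Models, auxSubsetAt, Sentence.Realize, Formula.realize_iAlls,
    Formula.realize_relabel, Formula.realize_imp]
  exact forall_congr' fun x => imp_congr (auxFact_mem_withAux D D' ⟨p, x⟩)
    (mainFact_mem_withAux D D' ⟨p, x⟩)

theorem repairCheckingFORewritable [Nonempty C] {Sg : Finset (Dependency S C)}
    (hSg : Acyclic Sg) : RepairCheckingFORewritable Sg := by
  refine ⟨bigAnd ((preds Sg).map (auxSubsetAt C)) ⊓ psiRc Sg, fun D D' hD hD' => ?_⟩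
  rw [isRepair_iff_subset hSg, ← models_psiRc Sg hD]
  let := S.dbl.struct (withAux D D')
  simp only [Models, Sentence.Realize, Formula.realize_inf, realize_bigAnd, List.forall_mem_map]
  refine and_congr ?_ Iff.rfl
  refine (forall₂_congr fun p _ => models_auxSubsetAt D D' p).trans ?_
  constructor
  · rintro h ⟨p, x⟩ hα
    exact h p (hD'.2 _ hα) x hα
  · exact fun h p _ x h₁ => h h₁

end Semantics

end CQA

namespace CQA

/-! ### Straight-line arithmetic in logarithmic space -/

theorem Exec.mono {b b' : ℕ} {P : Prog} {s s' : ℕ → ℕ} (hP : Exec b P s s') (h : b ≤ b') :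
    Exec b' P s s' := by
  induction hP with
  | const r k s hk => exact .const r k s (hk.trans h)
  | op o r x y s ho => exact .op o r x y s (ho.trans h)
  | seq _ _ ih₁ ih₂ => exact .seq ih₁ ih₂
  | ifTrue hr _ ih => exact .ifTrue hr ih
  | ifFalse hr _ ih => exact .ifFalse hr ih
  | whileFalse hr => exact .whileFalse hr
  | whileTrue hr _ _ ih₁ ih₂ => exact .whileTrue hr ih₁ ih₂

/-- Arithmetic expressions over registers. -/
inductive Ex where
  | reg (r : ℕ) : Ex
  | const (k : ℕ) : Ex
  | op (o : Op) (a b : Ex) : Ex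

namespace Ex

def eval (ρ : ℕ → ℕ) : Ex → ℕ
  | reg r => ρ r
  | const k => k
  | op o a b => o.eval (a.eval ρ) (b.eval ρ)

/-- All registers of the expression are less than `m`. -/
def RegsLT (m : ℕ) : Ex → Prop
  | reg r => r < m
  | const _ => True
  | op _ a b => a.RegsLT m ∧ b.RegsLT m

/-- The values of all subexpressions have at most `b` bits. -/
def BitsLE (ρ : ℕ → ℕ) (b : ℕ) : Ex → Prop
  | reg r => (ρ r).size ≤ b
  | const k => k.size ≤ b
  | op o x y => x.BitsLE ρ b ∧ y.BitsLE ρ b ∧ (o.eval (x.eval ρ) (y.eval ρ)).size ≤ b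

/-- A program that writes the value of the expression to register `r`. -/
def compile : Ex → ℕ → Prog
  | reg x, r => .seq (.const r 0) (.op .add r x r)
  | const k, r => .const r k
  | op o a b, r => .seq (a.compile r) (.seq (b.compile (r + 1)) (.op o r r (r + 1)))

theorem RegsLT.mono {m m' : ℕ} (h : m ≤ m') {e : Ex} (he : e.RegsLT m) : e.RegsLT m' := by
  induction e with
  | reg r => exact lt_of_lt_of_le he h
  | const k => trivial
  | op o a b iha ihb => exact ⟨iha he.1, ihb he.2⟩

theorem eval_congr {m : ℕ} {e : Ex} (he : e.RegsLT m) {ρ ρ' : ℕ → ℕ}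
    (h : ∀ r < m, ρ r = ρ' r) : e.eval ρ = e.eval ρ' := by
  induction e with
  | reg r => exact h r he
  | const k => rfl
  | op o a b iha ihb => simp only [eval, iha he.1, ihb he.2]

theorem exists_regsLT (e : Ex) : ∃ m, e.RegsLT m := by
  induction e with
  | reg r => exact ⟨r + 1, Nat.lt_succ_self r⟩
  | const k => exact ⟨0, trivial⟩
  | op o a b iha ihb =>
    obtain ⟨m, hm⟩ := iha
    obtain ⟨m', hm'⟩ := ihb
    exact ⟨max m m', hm.mono (le_max_left _ _), hm'.mono (le_max_right _ _)⟩

theorem BitsLE.mono {ρ : ℕ → ℕ} {b b' : ℕ} (h : b ≤ b') {e : Ex} (he : e.BitsLE ρ b) :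
    e.BitsLE ρ b' := by
  induction e with
  | reg r => exact le_trans he h
  | const k => exact le_trans he h
  | op o x y ihx ihy => exact ⟨ihx he.1, ihy he.2.1, he.2.2.trans h⟩

theorem BitsLE.size_eval_le {ρ : ℕ → ℕ} {b : ℕ} {e : Ex} (he : e.BitsLE ρ b) :
    (e.eval ρ).size ≤ b := by
  cases e with
  | reg r => exact he
  | const k => exact he
  | op o x y => exact he.2.2

theorem size_mul_le (a b : ℕ) : (a * b).size ≤ a.size + b.size := by
  rw [Nat.size_le, pow_add]
  exact Nat.mul_lt_mul'' (Nat.lt_size_self a) (Nat.lt_size_self b)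

theorem size_add_le (a b : ℕ) : (a + b).size ≤ a.size + b.size + 1 := by
  rw [Nat.size_le, pow_succ]
  have ha : a < 2 ^ (a.size + b.size) :=
    (Nat.lt_size_self a).trans_le (Nat.pow_le_pow_right two_pos (Nat.le_add_right _ _))
  have hb : b < 2 ^ (a.size + b.size) :=
    (Nat.lt_size_self b).trans_le (Nat.pow_le_pow_right two_pos (Nat.le_add_left _ _))
  lia

theorem size_op_le (o : Op) (a b : ℕ) : (o.eval a b).size ≤ a.size + b.size + 1 := by
  have h : ∀ c ≤ a, c.size ≤ a.size + b.size + 1 := fun c hc =>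
    (Nat.size_le_size hc).trans (by lia)
  cases o with
  | add => exact size_add_le a b
  | sub => exact h _ (Nat.sub_le a b)
  | mul => exact (size_mul_le a b).trans (Nat.le_succ _)
  | div => exact h _ (Nat.div_le_self a b)
  | mod => exact h _ (Nat.mod_le a b)

theorem exists_bitsLE (e : Ex) :
    ∃ c, ∀ (ρ : ℕ → ℕ) (b : ℕ), (∀ r, (ρ r).size ≤ b) → e.BitsLE ρ (c * (b + 1)) := by
  induction e with
  | reg r => exact ⟨1, fun ρ b h => (h r).trans (by lia)⟩
  | const k => exact ⟨k.size, fun ρ b _ => Nat.le_mul_of_pos_right _ (Nat.succ_pos b)⟩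
  | op o x y ihx ihy =>
    obtain ⟨c, hc⟩ := ihx
    obtain ⟨d, hd⟩ := ihy
    refine ⟨c + d + 1, fun ρ b h => ?_⟩
    have e₁ : (c + d + 1) * (b + 1) = c * (b + 1) + d * (b + 1) + (b + 1) := by ring
    refine ⟨(hc ρ b h).mono (by lia), (hd ρ b h).mono (by lia), ?_⟩
    have h₁ := (hc ρ b h).size_eval_le
    have h₂ := (hd ρ b h).size_eval_le
    have h₃ := size_op_le o (x.eval ρ) (y.eval ρ)
    lia

theorem exec_compile {ρ : ℕ → ℕ} {b m : ℕ} {e : Ex} (hb : e.BitsLE ρ b) (hm : e.RegsLT m) (r : ℕ)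
    (hr : m ≤ r) (s : ℕ → ℕ) (hs : ∀ x < m, s x = ρ x) :
    ∃ s', Exec b (e.compile r) s s' ∧ s' r = e.eval ρ ∧ ∀ x < r, s' x = s x := by
  induction e generalizing r s with
  | reg x =>
    have hx : x < r := lt_of_lt_of_le hm hr
    have hv : Op.add.eval (Function.update s r 0 x) (Function.update s r 0 r) = ρ x := by
      simp [Op.eval, Function.update_of_ne hx.ne, hs x hm]
    refine ⟨_, .seq (.const r 0 s (by simp)) (.op .add r x r _ (by rw [hv]; exact hb)), ?_, ?_⟩
    · rw [Function.update_self, hv, eval]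
    · intro y hy
      rw [Function.update_of_ne hy.ne, Function.update_of_ne hy.ne]
  | const k =>
    exact ⟨_, .const r k s hb, Function.update_self .., fun x hx => Function.update_of_ne hx.ne ..⟩
  | op o x y ihx ihy =>
    obtain ⟨s₁, h₁, e₁, f₁⟩ := ihx hb.1 hm.1 r hr s hs
    obtain ⟨s₂, h₂, e₂, f₂⟩ := ihy hb.2.1 hm.2 (r + 1) (by lia) s₁
      fun z hz => (f₁ z (lt_of_lt_of_le hz hr)).trans (hs z hz)
    have e₃ : s₂ r = x.eval ρ := (f₂ r (Nat.lt_succ_self r)).trans e₁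
    refine ⟨_, .seq h₁ (.seq h₂ (.op o r r (r + 1) s₂ (by rw [e₂, e₃]; exact hb.2.2))), ?_, ?_⟩
    · rw [Function.update_self, e₂, e₃, eval]
    · intro z hz
      rw [Function.update_of_ne hz.ne, f₂ z (by lia), f₁ z hz]

/-- A program that writes the value of an expression over three input registers to register `0`. -/
def prog (e : Ex) : Prog :=
  .seq (e.compile 3) (.seq (.const 4 0) (.op .add 0 3 4))

theorem computes_prog {e : Ex} (he : e.RegsLT 3) :
    ∃ c, ∀ (inputs : List ℕ) (b : ℕ), (∀ x ∈ inputs, x.size ≤ b) →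
      e.prog.Computes (c * (b + 1)) inputs (e.eval fun r => inputs.getD r 0) := by
  obtain ⟨c, hc⟩ := exists_bitsLE e
  refine ⟨c, fun inputs b hb => ?_⟩
  have hbits := hc (fun r => inputs.getD r 0) b fun r => by
    rw [List.getD_eq_getElem?_getD]
    rcases h : inputs[r]? with _ | x
    · simp
    · exact hb x (List.mem_of_getElem? h)
  obtain ⟨s, h₁, h₂, -⟩ := exec_compile hbits he 3 le_rfl (fun r => inputs.getD r 0) fun _ _ => rfl
  have hv : Op.add.eval (Function.update s 4 0 3) (Function.update s 4 0 4) =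
      e.eval fun r => inputs.getD r 0 := by
    simp [Op.eval, Function.update_of_ne, h₂]
  refine ⟨_, .seq h₁ (.seq (.const 4 0 s (by simp)) (.op .add 0 3 4 _ ?_)), ?_⟩
  · rw [hv]
    exact hbits.size_eval_le
  · rw [Function.update_self, hv]

/-! ### Derived operations -/

def add (a b : Ex) : Ex := op .add a b
def sub (a b : Ex) : Ex := op .sub a b
def mul (a b : Ex) : Ex := op .mul a b
def div (a b : Ex) : Ex := op .div a b
def mod (a b : Ex) : Ex := op .mod a b

def pow (a : Ex) : ℕ → Ex
  | 0 => const 1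
  | n + 1 => mul (pow a n) a

/-- `if c ≠ 0 then a else b` -/
def ite (c a b : Ex) : Ex :=
  add (mul (sub (const 1) (sub (const 1) c)) a) (mul (sub (const 1) c) b)

/-- `1` if the values are equal, otherwise `0` -/
def eq (a b : Ex) : Ex := sub (const 1) (add (sub a b) (sub b a))

/-- the product of the values of `f` over a list -/
def prod {α : Type} (l : List α) (f : α → Ex) : Ex := l.foldr (fun a e => mul (f a) e) (const 1)

/-- replacement of registers by expressions -/
def subst (f : ℕ → Ex) : Ex → Ex
  | reg r => f r
  | const k => const k
  | op o a b => op o (a.subst f) (b.subst f)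

/-- the value of `f` at the entry of the list with number `j`, or `0` if there is none -/
def select {α : Type} (f : α → Ex) : List α → Ex → Ex
  | [], _ => const 0
  | a :: l, j => ite j (select f l (sub j (const 1))) (f a)

variable (ρ : ℕ → ℕ)

@[simp] theorem eval_reg (r : ℕ) : (reg r).eval ρ = ρ r := rfl
@[simp] theorem eval_const (k : ℕ) : (const k).eval ρ = k := rfl
@[simp] theorem eval_add (a b : Ex) : (add a b).eval ρ = a.eval ρ + b.eval ρ := rfl
@[simp] theorem eval_sub (a b : Ex) : (sub a b).eval ρ = a.eval ρ - b.eval ρ := rfl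
@[simp] theorem eval_mul (a b : Ex) : (mul a b).eval ρ = a.eval ρ * b.eval ρ := rfl
@[simp] theorem eval_div (a b : Ex) : (div a b).eval ρ = a.eval ρ / b.eval ρ := rfl
@[simp] theorem eval_mod (a b : Ex) : (mod a b).eval ρ = a.eval ρ % b.eval ρ := rfl

@[simp] theorem eval_pow (a : Ex) (n : ℕ) : (pow a n).eval ρ = a.eval ρ ^ n := by
  induction n with
  | zero => rfl
  | succ n ih => rw [pow, eval_mul, ih, pow_succ]

@[simp] theorem eval_ite (c a b : Ex) :
    (ite c a b).eval ρ = if c.eval ρ ≠ 0 then a.eval ρ else b.eval ρ := by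
  by_cases h : c.eval ρ = 0
  · simp [ite, h]
  · simp [ite, h, Nat.sub_eq_zero_of_le (Nat.one_le_iff_ne_zero.2 h)]

@[simp] theorem eval_eq (a b : Ex) :
    (eq a b).eval ρ = if a.eval ρ = b.eval ρ then 1 else 0 := by
  simp only [eq, eval_sub, eval_const, eval_add]
  split_ifs <;> lia

theorem eval_prod {α : Type} (l : List α) (f : α → Ex) (P : α → Prop) [DecidablePred P]
    (h : ∀ a ∈ l, (f a).eval ρ = if P a then 1 else 0) :
    (prod l f).eval ρ = if ∀ a ∈ l, P a then 1 else 0 := by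
  induction l with
  | nil => simp [prod]
  | cons a l ih =>
    have : prod (a :: l) f = mul (f a) (prod l f) := rfl
    rw [this, eval_mul, h a (by simp), ih fun e he => h e (by simp [he])]
    by_cases h₁ : P a <;> simp [h₁]

theorem eval_subst (f : ℕ → Ex) (e : Ex) :
    (e.subst f).eval ρ = e.eval fun r => (f r).eval ρ := by
  induction e with
  | reg r => rfl
  | const k => rfl
  | op o a b iha ihb => simp only [subst, eval, iha, ihb]

theorem eval_select {α : Type} (f : α → Ex) (l : List α) (j : Ex) :
    (select f l j).eval ρ = (l[j.eval ρ]?).elim 0 fun a => (f a).eval ρ := by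
  induction l generalizing j with
  | nil => simp [select]
  | cons a l ih =>
    rw [select, eval_ite, ih]
    rcases h : j.eval ρ with _ | i <;> simp [h]

variable {m : ℕ}

theorem RegsLT.pow {a : Ex} (h : a.RegsLT m) (n : ℕ) : (pow a n).RegsLT m := by
  induction n with
  | zero => trivial
  | succ n ih => exact ⟨ih, h⟩

theorem RegsLT.ite {c a b : Ex} (hc : c.RegsLT m) (ha : a.RegsLT m) (hb : b.RegsLT m) :
    (ite c a b).RegsLT m :=
  ⟨⟨⟨trivial, trivial, hc⟩, ha⟩, ⟨trivial, hc⟩, hb⟩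

theorem RegsLT.eq {a b : Ex} (ha : a.RegsLT m) (hb : b.RegsLT m) : (eq a b).RegsLT m :=
  ⟨trivial, ⟨ha, hb⟩, hb, ha⟩

theorem RegsLT.prod {α : Type} {l : List α} {f : α → Ex} (h : ∀ a ∈ l, (f a).RegsLT m) :
    (prod l f).RegsLT m := by
  induction l with
  | nil => trivial
  | cons a l ih => exact ⟨h a (by simp), ih fun e he => h e (by simp [he])⟩

theorem RegsLT.subst {f : ℕ → Ex} (hf : ∀ r, (f r).RegsLT m) (e : Ex) : (e.subst f).RegsLT m := by
  induction e with
  | reg r => exact hf r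
  | const k => trivial
  | op o a b iha ihb => exact ⟨iha, ihb⟩

theorem RegsLT.select {α : Type} {f : α → Ex} {l : List α} (hf : ∀ a ∈ l, (f a).RegsLT m) {j : Ex}
    (hj : j.RegsLT m) : (select f l j).RegsLT m := by
  induction l generalizing j with
  | nil => trivial
  | cons a l ih =>
    exact RegsLT.ite hj (ih (fun b hb => hf b (by simp [hb])) ⟨hj, trivial⟩) (hf a (by simp))

end Ex

end CQA

namespace CQA

/-! ### Formulas of bounded arithmetic over a bit string -/

/-- Formulas over a bit string `w`: arithmetic conditions `e ≠ 0`, bits `w[e]`, Boolean connectives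
and bounded quantifiers. In expressions, register `0` is the length of `w` and register `x + 1` is
the variable `x`. -/
inductive BF where
  | cond (e : Ex) : BF
  | bit (e : Ex) : BF
  | not (φ : BF) : BF
  | and (φ ψ : BF) : BF
  | ex (x : ℕ) (φ : BF) : BF

/-- The register contents for a length and an assignment of the variables. -/
def regs (n : ℕ) (v : ℕ → ℕ) : ℕ → ℕ
  | 0 => n
  | x + 1 => v x

/-- Truth of a formula; the quantifiers range over the numbers up to `|w| + k`. -/
def BF.Holds (k : ℕ) (w : List Bool) : BF → (ℕ → ℕ) → Prop
  | cond e, v => e.eval (regs w.length v) ≠ 0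
  | bit e, v => w[e.eval (regs w.length v)]? = some true
  | not φ, v => ¬ φ.Holds k w v
  | and φ ψ, v => φ.Holds k w v ∧ ψ.Holds k w v
  | ex x φ, v => ∃ a < w.length + k + 1, φ.Holds k w (Function.update v x a)

/-- All variables of the formula are less than `q`. -/
def BF.VarsLT (q : ℕ) : BF → Prop
  | cond e => e.RegsLT (q + 1)
  | bit e => e.RegsLT (q + 1)
  | not φ => φ.VarsLT q
  | and φ ψ => φ.VarsLT q ∧ ψ.VarsLT q
  | ex x φ => x < q ∧ φ.VarsLT q

theorem BF.VarsLT.mono {q q' : ℕ} (h : q ≤ q') {φ : BF} (hφ : φ.VarsLT q) : φ.VarsLT q' := by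
  induction φ with
  | cond e => exact Ex.RegsLT.mono (Nat.succ_le_succ h) hφ
  | bit e => exact Ex.RegsLT.mono (Nat.succ_le_succ h) hφ
  | not φ ih => exact ih hφ
  | and φ ψ ih₁ ih₂ => exact ⟨ih₁ hφ.1, ih₂ hφ.2⟩
  | ex x φ ih => exact ⟨hφ.1.trans_le h, ih hφ.2⟩

theorem BF.exists_varsLT (φ : BF) : ∃ q, φ.VarsLT q := by
  induction φ with
  | cond e =>
    obtain ⟨m, hm⟩ := e.exists_regsLT
    exact ⟨m, hm.mono (Nat.le_succ m)⟩
  | bit e =>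
    obtain ⟨m, hm⟩ := e.exists_regsLT
    exact ⟨m, hm.mono (Nat.le_succ m)⟩
  | not φ ih => exact ih
  | and φ ψ ih₁ ih₂ =>
    obtain ⟨q, hq⟩ := ih₁
    obtain ⟨q', hq'⟩ := ih₂
    exact ⟨max q q', hq.mono (le_max_left _ _), hq'.mono (le_max_right _ _)⟩
  | ex x φ ih =>
    obtain ⟨q, hq⟩ := ih
    exact ⟨max q (x + 1), lt_of_lt_of_le (Nat.lt_succ_self x) (le_max_right _ _),
      hq.mono (le_max_left _ _)⟩

theorem regs_congr {q n : ℕ} {v v' : ℕ → ℕ} (h : ∀ x < q, v x = v' x) :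
    ∀ r < q + 1, regs n v r = regs n v' r
  | 0, _ => rfl
  | x + 1, hx => h x (Nat.lt_of_succ_lt_succ hx)

theorem BF.holds_congr {k q : ℕ} {w : List Bool} {φ : BF} (hφ : φ.VarsLT q) {v v' : ℕ → ℕ}
    (h : ∀ x < q, v x = v' x) : φ.Holds k w v ↔ φ.Holds k w v' := by
  induction φ generalizing v v' with
  | cond e => simp only [Holds, Ex.eval_congr hφ (regs_congr h)]
  | bit e => simp only [Holds, Ex.eval_congr hφ (regs_congr h)]
  | not φ ih => exact not_congr (ih hφ h)
  | and φ ψ ih₁ ih₂ => exact and_congr (ih₁ hφ.1 h) (ih₂ hφ.2 h)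
  | ex x φ ih =>
    refine exists_congr fun a => and_congr_right fun _ => ih hφ.2 fun y hy => ?_
    by_cases hxy : y = x
    · subst hxy; simp
    · simp [hxy, h y hy]

/-! ### Formulas as lists of nodes -/

/-- The nodes of formulas; subformulas are given by their numbers in a list of nodes. -/
inductive Node where
  | cond (e : Ex) : Node
  | bit (e : Ex) : Node
  | not (i : ℕ) : Node
  | and (i j : ℕ) : Node
  | ex (x i : ℕ) : Node

/-- `i` is the number of an immediate subformula. -/
def Node.Child : Node → ℕ → Prop
  | cond _, _ => False
  | bit _, _ => False
  | not j, i => i = j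
  | and j j', i => i = j ∨ i = j'
  | ex _ j, i => i = j

/-- Immediate subformulas come before the formula. -/
def Ordered (l : List Node) : Prop :=
  ∀ (i : ℕ) (nd : Node), l[i]? = some nd → ∀ j, nd.Child j → j < i

/-- The entry `i` of the list represents the formula. -/
def Represents (l : List Node) : ℕ → BF → Prop
  | i, .cond e => l[i]? = some (.cond e)
  | i, .bit e => l[i]? = some (.bit e)
  | i, .not φ => ∃ j, l[i]? = some (.not j) ∧ Represents l j φ
  | i, .and φ ψ => ∃ j j', l[i]? = some (.and j j') ∧ Represents l j φ ∧ Represents l j' ψ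
  | i, .ex x φ => ∃ j, l[i]? = some (.ex x j) ∧ Represents l j φ

theorem getElem?_append_of_some {α : Type} {l : List α} (l' : List α) {i : ℕ} {a : α}
    (h : l[i]? = some a) : (l ++ l')[i]? = some a := by
  rw [List.getElem?_append_left (List.getElem?_eq_some_iff.1 h).1, h]

theorem Represents.append {l : List Node} (l' : List Node) {i : ℕ} {φ : BF}
    (h : Represents l i φ) : Represents (l ++ l') i φ := by
  induction φ generalizing i with
  | cond e => exact getElem?_append_of_some l' h
  | bit e => exact getElem?_append_of_some l' h
  | not φ ih =>
    obtain ⟨j, h, hj⟩ := h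
    exact ⟨j, getElem?_append_of_some l' h, ih hj⟩
  | and φ ψ ih₁ ih₂ =>
    obtain ⟨j, j', h, hj, hj'⟩ := h
    exact ⟨j, j', getElem?_append_of_some l' h, ih₁ hj, ih₂ hj'⟩
  | ex x φ ih =>
    obtain ⟨j, h, hj⟩ := h
    exact ⟨j, getElem?_append_of_some l' h, ih hj⟩

theorem Represents.lt_length {l : List Node} {i : ℕ} {φ : BF} (h : Represents l i φ) :
    i < l.length := by
  cases φ with
  | cond e => exact (List.getElem?_eq_some_iff.1 h).1
  | bit e => exact (List.getElem?_eq_some_iff.1 h).1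
  | not φ => exact (List.getElem?_eq_some_iff.1 h.choose_spec.1).1
  | and φ ψ => exact (List.getElem?_eq_some_iff.1 h.choose_spec.choose_spec.1).1
  | ex x φ => exact (List.getElem?_eq_some_iff.1 h.choose_spec.1).1

theorem Ordered.append {l : List Node} (hl : Ordered l) {nd : Node}
    (h : ∀ j, nd.Child j → j < l.length) : Ordered (l ++ [nd]) := by
  intro i nd' hi j hj
  rcases lt_trichotomy i l.length with hlt | rfl | hgt
  · rw [List.getElem?_append_left hlt] at hi
    exact hl i nd' hi j hj
  · simp only [List.getElem?_append_right le_rfl, Nat.sub_self, List.getElem?_cons_zero,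
      Option.some.injEq] at hi
    exact h j (hi ▸ hj)
  · have := (List.getElem?_eq_some_iff.1 hi).1
    simp only [List.length_append, List.length_singleton] at this
    lia

theorem exists_represents (φ : BF) (l : List Node) (hl : Ordered l) :
    ∃ l' i, Ordered (l ++ l') ∧ Represents (l ++ l') i φ := by
  induction φ generalizing l with
  | cond e =>
    exact ⟨[.cond e], l.length, hl.append fun j hj => hj.elim, by simp [Represents]⟩
  | bit e =>
    exact ⟨[.bit e], l.length, hl.append fun j hj => hj.elim, by simp [Represents]⟩
  | not φ ih =>
    obtain ⟨l₁, i, h₁, h₂⟩ := ih l hl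
    refine ⟨l₁ ++ [.not i], (l ++ l₁).length, ?_, i, ?_, ?_⟩
    · rw [← List.append_assoc]
      exact h₁.append fun j hj => hj ▸ h₂.lt_length
    · rw [← List.append_assoc]; simp
    · rw [← List.append_assoc]; exact h₂.append _
  | and φ ψ ih₁ ih₂ =>
    obtain ⟨l₁, i, h₁, h₂⟩ := ih₁ l hl
    obtain ⟨l₂, j, h₃, h₄⟩ := ih₂ _ h₁
    refine ⟨l₁ ++ l₂ ++ [.and i j], (l ++ l₁ ++ l₂).length, ?_, i, j, ?_, ?_, ?_⟩
    · rw [← List.append_assoc, ← List.append_assoc]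
      refine h₃.append ?_
      rintro _ (rfl | rfl)
      · exact (h₂.append l₂).lt_length
      · exact h₄.lt_length
    · rw [← List.append_assoc, ← List.append_assoc]; simp
    · rw [← List.append_assoc, ← List.append_assoc]; exact (h₂.append _).append _
    · rw [← List.append_assoc, ← List.append_assoc]; exact h₄.append _
  | ex x φ ih =>
    obtain ⟨l₁, i, h₁, h₂⟩ := ih l hl
    refine ⟨l₁ ++ [.ex x i], (l ++ l₁).length, ?_, i, ?_, ?_⟩
    · rw [← List.append_assoc]
      exact h₁.append fun j hj => hj ▸ h₂.lt_length
    · rw [← List.append_assoc]; simp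
    · rw [← List.append_assoc]; exact h₂.append _

/-! ### The circuits of a formula -/

section Circuits

/-- The digit number `x` of `g` in base `b`. -/
def digit (b g x : ℕ) : ℕ := g / b ^ x % b

theorem digit_mul_pow_add (b q j m x : ℕ) (hx : x < q) :
    digit b (j * b ^ q + m) x = digit b m x := by
  rcases Nat.eq_zero_or_pos b with rfl | hb
  · have : q ≠ 0 := by lia
    simp [digit, this]
  obtain ⟨d, rfl⟩ := Nat.exists_eq_add_of_lt hx
  have : j * b ^ (x + d + 1) + m = m + b ^ x * (b * (j * b ^ d)) := by ring
  rw [digit, digit, this, Nat.add_mul_div_left _ _ (pow_pos hb x), Nat.add_mul_mod_self_left]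

theorem exists_digits {b q : ℕ} (u : ℕ → ℕ) (hu : ∀ x < q, u x < b) :
    ∃ m < b ^ q, ∀ x < q, digit b m x = u x := by
  refine ⟨finFunctionFinEquiv fun x : Fin q => (⟨u x, hu x x.2⟩ : Fin b), Fin.is_lt _,
    fun x hx => ?_⟩
  have := congrFun (finFunctionFinEquiv.symm_apply_apply
    fun x : Fin q => (⟨u x, hu x x.2⟩ : Fin b)) ⟨x, hx⟩
  rw [Fin.ext_iff, finFunctionFinEquiv_symm_apply_val] at this
  exact this

variable (l : List Node) (q k n : ℕ)

/-- The expression over the registers `0 = n`, `1 = g`, `2 = h` for the number of values of a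
variable. -/
def baseE : Ex := .add (.reg 0) (.const (k + 1))

def digitE (r x : ℕ) : Ex := .mod (.div (.reg r) (.pow (baseE k) x)) (baseE k)

def nodeE (r : ℕ) : Ex := .div (.reg r) (.pow (baseE k) q)

def codeE (r : ℕ) : Ex := .mod (.reg r) (.pow (baseE k) q)

/-- The expression for the value of an expression at the assignment of the gate in register `1`. -/
def gateE (e : Ex) : Ex :=
  e.subst fun
    | 0 => .reg 0
    | x + 1 => digitE k 1 x

/-- Gate `h` is wired to gate `g`, which belongs to the given node. The gates are the pairs of a node
and an assignment of the `q` variables. -/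
def NodeWire (g h : ℕ) : Node → Prop
  | .cond _ => False
  | .bit _ => False
  | .not i => h / (n + k + 1) ^ q = i ∧ h % (n + k + 1) ^ q = g % (n + k + 1) ^ q
  | .and i j => (h / (n + k + 1) ^ q = i ∨ h / (n + k + 1) ^ q = j) ∧
      h % (n + k + 1) ^ q = g % (n + k + 1) ^ q
  | .ex x i => h / (n + k + 1) ^ q = i ∧
      ∀ y ∈ List.range q, y = x ∨ digit (n + k + 1) h y = digit (n + k + 1) g y

def Wire (g h : ℕ) : Prop :=
  ∃ nd, l[g / (n + k + 1) ^ q]? = some nd ∧ NodeWire q k n g h nd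

def nodeWireE : Node → Ex
  | .cond _ => .const 0
  | .bit _ => .const 0
  | .not i => .mul (.eq (nodeE q k 2) (.const i)) (.eq (codeE q k 2) (codeE q k 1))
  | .and i j => .mul (.ite (.eq (nodeE q k 2) (.const i)) (.const 1)
      (.eq (nodeE q k 2) (.const j))) (.eq (codeE q k 2) (codeE q k 1))
  | .ex x i => .mul (.eq (nodeE q k 2) (.const i)) (.prod (List.range q) fun y =>
      if y = x then .const 1 else .eq (digitE k 2 y) (digitE k 1 y))

def wireE : Ex := .select (nodeWireE q k) l (nodeE q k 1)

open scoped Classical in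
/-- The kind of a gate that belongs to the given node. -/
noncomputable def nodeKind (g : ℕ) : Node → GateKind n
  | .cond e => if e.eval (regs n (digit (n + k + 1) g)) ≠ 0 then .and else .or
  | .bit e => if h : e.eval (regs n (digit (n + k + 1) g)) < n then .input ⟨_, h⟩ else .or
  | .not _ => .not
  | .and _ _ => .and
  | .ex _ _ => .or

def nodeKindE : Node → Ex
  | .cond e => .ite (gateE k e) (.const 0) (.const 1)
  | .bit e => .ite (.sub (.reg 0) (gateE k e)) (.add (gateE k e) (.const 3)) (.const 1)
  | .not _ => .const 2
  | .and _ _ => .const 0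
  | .ex _ _ => .const 1

def kindE : Ex := .select (nodeKindE k) l (nodeE q k 1)

noncomputable def gateKind (g : ℕ) : GateKind n :=
  (l[g / (n + k + 1) ^ q]?).elim .or (nodeKind k n g)

variable {l q k n}

theorem Wire.lt (hl : Ordered l) {g h : ℕ} (hw : Wire l q k n g h) :
    h / (n + k + 1) ^ q < g / (n + k + 1) ^ q := by
  obtain ⟨nd, h₁, h₂⟩ := hw
  refine hl _ nd h₁ _ ?_
  cases nd with
  | cond e => exact h₂
  | bit e => exact h₂
  | not i => exact h₂.1
  | and i j => exact h₂.1
  | ex x i => exact h₂.1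

theorem node_lt_length (g : Fin (l.length * (n + k + 1) ^ q)) :
    g / (n + k + 1) ^ q < l.length :=
  Nat.div_lt_of_lt_mul (g.2.trans_eq (mul_comm _ _))

theorem gate_lt {j m : ℕ} (hj : j < l.length) (hm : m < (n + k + 1) ^ q) :
    j * (n + k + 1) ^ q + m < l.length * (n + k + 1) ^ q :=
  calc j * (n + k + 1) ^ q + m < (j + 1) * (n + k + 1) ^ q := by rw [add_mul, one_mul]; lia
    _ ≤ _ := Nat.mul_le_mul_right _ hj

theorem mul_add_div_of_lt {b j m : ℕ} (hm : m < b) : (j * b + m) / b = j := by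
  rw [mul_comm, Nat.mul_add_div (by lia), Nat.div_eq_of_lt hm, add_zero]

theorem mul_add_mod_of_lt {b j m : ℕ} (hm : m < b) : (j * b + m) % b = m := by
  rw [mul_comm, Nat.mul_add_mod, Nat.mod_eq_of_lt hm]

open scoped Classical in
/-- The circuit of a list of nodes, with the gates of the node `i` at the output. -/
noncomputable def nodeCircuit (hl : Ordered l) {i : ℕ} (hi : i < l.length) (q k n : ℕ) :
    Circuit n where
  size := l.length * (n + k + 1) ^ q
  kind g := gateKind l q k n g
  wire g h := decide (Wire l q k n g h)
  out := ⟨i * (n + k + 1) ^ q + 0, gate_lt hi (pow_pos (Nat.succ_pos _) q)⟩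
  wire_lt g h hw := by
    have := (of_decide_eq_true hw).lt hl
    rw [Fin.lt_def]
    by_contra hle
    exact this.not_ge (Nat.div_le_div_right (not_lt.1 hle))
  input_fanin g i hg h := by
    rw [decide_eq_false_iff_not]
    rintro ⟨nd, h₁, h₂⟩
    rw [gateKind, h₁, Option.elim_some] at hg
    cases nd with
    | cond e => exact h₂
    | bit e => exact h₂
    | not i => cases hg
    | and i j => cases hg
    | ex x i => cases hg
  not_fanin g hg := by
    obtain ⟨nd, h₁⟩ : ∃ nd, l[(g : ℕ) / (n + k + 1) ^ q]? = some nd :=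
      ⟨_, List.getElem?_eq_getElem (node_lt_length g)⟩
    rw [gateKind, h₁, Option.elim_some] at hg
    cases nd with
    | cond e => simp only [nodeKind] at hg; split_ifs at hg
    | bit e => simp only [nodeKind] at hg; split_ifs at hg
    | and i j => cases hg
    | ex x i => cases hg
    | not i =>
      have hi : i < l.length := (hl _ _ h₁ i rfl).trans (node_lt_length g)
      have hm : (g : ℕ) % (n + k + 1) ^ q < (n + k + 1) ^ q :=
        Nat.mod_lt _ (pow_pos (Nat.succ_pos _) q)
      refine ⟨⟨i * (n + k + 1) ^ q + g % (n + k + 1) ^ q, gate_lt hi hm⟩, ?_, ?_⟩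
      · exact decide_eq_true ⟨_, h₁, mul_add_div_of_lt hm, mul_add_mod_of_lt hm⟩
      · rintro h hh
        obtain ⟨nd, h₂, h₃⟩ := of_decide_eq_true hh
        rw [h₁, Option.some.injEq] at h₂
        subst h₂
        rw [Fin.ext_iff, ← Nat.div_add_mod' (h : ℕ) ((n + k + 1) ^ q), h₃.1, h₃.2]

end Circuits

end CQA

namespace CQA

section Correctness

variable {l : List Node} {q k : ℕ}

theorem nodeCircuit_wire (hl : Ordered l) {i n : ℕ} (hi : i < l.length)
    (g h : Fin (nodeCircuit hl hi q k n).size) :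
    (nodeCircuit hl hi q k n).wire g h = true ↔ Wire l q k n g h := by
  classical
  exact decide_eq_true_iff

theorem nodeCircuit_depthLE (hl : Ordered l) {i : ℕ} (hi : i < l.length) (n : ℕ) :
    (nodeCircuit hl hi q k n).DepthLE l.length := by
  intro L hL
  have key : ∀ (L : List (Fin (nodeCircuit hl hi q k n).size)) (g),
      (g :: L).IsChain (fun g h => (nodeCircuit hl hi q k n).wire g h = true) →
      (g :: L).length ≤ (g : ℕ) / (n + k + 1) ^ q + 1 := by
    intro L
    induction L with
    | nil => intro g _; simp
    | cons h L ih =>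
      intro g hg
      rw [List.isChain_cons_cons] at hg
      have h₁ := ih h hg.2
      have h₂ := ((nodeCircuit_wire hl hi g h).1 hg.1).lt hl
      simp only [List.length_cons] at h₁ ⊢
      lia
  cases L with
  | nil => simp
  | cons g L =>
    have h₁ := key L g hL
    have h₂ : (g : ℕ) / (n + k + 1) ^ q < l.length := node_lt_length g
    lia

theorem digit_congr_of_mod {b g h x : ℕ} (hx : x < q) (e : h % b ^ q = g % b ^ q) :
    digit b h x = digit b g x := by
  rw [← Nat.div_add_mod' h (b ^ q), ← Nat.div_add_mod' g (b ^ q), digit_mul_pow_add _ _ _ _ _ hx,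
    digit_mul_pow_add _ _ _ _ _ hx, e]

theorem value_nodeCircuit (hl : Ordered l) {i₀ : ℕ} (hi₀ : i₀ < l.length) (w : List Bool) (φ : BF)
    (hφ : φ.VarsLT q) (g : Fin (nodeCircuit hl hi₀ q k w.length).size)
    (hg : Represents l (g / (w.length + k + 1) ^ q) φ) :
    (nodeCircuit hl hi₀ q k w.length).Value w.get g ↔
      φ.Holds k w (digit (w.length + k + 1) g) := by
  have hpos : 0 < (w.length + k + 1) ^ q := pow_pos (Nat.succ_pos _) q
  have hkind : ∀ (g : Fin (nodeCircuit hl hi₀ q k w.length).size) {nd : Node},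
      l[(g : ℕ) / (w.length + k + 1) ^ q]? = some nd →
      (nodeCircuit hl hi₀ q k w.length).kind g = nodeKind k w.length g nd := by
    intro g nd hnd
    change gateKind l q k w.length g = _
    rw [gateKind, hnd, Option.elim_some]
  have hwire : ∀ (g : Fin (nodeCircuit hl hi₀ q k w.length).size) {nd : Node},
      l[(g : ℕ) / (w.length + k + 1) ^ q]? = some nd →
      ∀ h, (nodeCircuit hl hi₀ q k w.length).wire g h = true ↔ NodeWire q k w.length g h nd := by
    intro g nd hnd h
    refine (nodeCircuit_wire hl hi₀ g h).trans ⟨?_, fun hh => ⟨nd, hnd, hh⟩⟩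
    rintro ⟨nd', h₁, h₂⟩
    rw [hnd, Option.some.injEq] at h₁
    exact h₁ ▸ h₂
  have hex : ∀ {j m : ℕ}, j < l.length → m < (w.length + k + 1) ^ q →
      ∃ h : Fin (nodeCircuit hl hi₀ q k w.length).size,
        (h : ℕ) / (w.length + k + 1) ^ q = j ∧ (h : ℕ) % (w.length + k + 1) ^ q = m ∧
          ∀ x < q, digit (w.length + k + 1) h x = digit (w.length + k + 1) m x :=
    fun hj hm => ⟨⟨_, gate_lt hj hm⟩, mul_add_div_of_lt hm, mul_add_mod_of_lt hm,
      fun x hx => digit_mul_pow_add _ _ _ _ _ hx⟩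
  induction φ generalizing g with
  | cond e =>
    have hk := hkind g hg
    rw [nodeKind] at hk
    rw [Circuit.Value]
    by_cases he : e.eval (regs w.length (digit (w.length + k + 1) g)) ≠ 0
    · rw [if_pos he] at hk
      rw [hk]
      exact iff_of_true (fun h hw => ((hwire g hg h).1 hw).elim) he
    · rw [if_neg he] at hk
      rw [hk]
      exact iff_of_false (fun ⟨h, hw, _⟩ => ((hwire g hg h).1 hw).elim) he
  | bit e =>
    have hk := hkind g hg
    rw [nodeKind] at hk
    rw [Circuit.Value]
    by_cases he : e.eval (regs w.length (digit (w.length + k + 1) g)) < w.length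
    · rw [dif_pos he] at hk
      rw [hk]
      simp only [BF.Holds, List.getElem?_eq_getElem he, Option.some.injEq]
      rfl
    · rw [dif_neg he] at hk
      rw [hk]
      refine iff_of_false (fun ⟨h, hw, _⟩ => ((hwire g hg h).1 hw).elim) ?_
      simp only [BF.Holds, List.getElem?_eq_none (not_lt.1 he)]
      simp
  | not φ ih =>
    obtain ⟨j, h₁, h₂⟩ := hg
    rw [Circuit.Value, hkind g h₁, nodeKind]
    have key : ∀ h : Fin (nodeCircuit hl hi₀ q k w.length).size,
        NodeWire q k w.length g h (.not j) →
        ((nodeCircuit hl hi₀ q k w.length).Value w.get h ↔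
          φ.Holds k w (digit (w.length + k + 1) g)) := fun h hh =>
      (ih hφ h (hh.1.symm ▸ h₂)).trans
        (BF.holds_congr (φ := φ) hφ fun x hx => digit_congr_of_mod hx hh.2)
    obtain ⟨h₀, e₁, e₂, -⟩ := hex h₂.lt_length (Nat.mod_lt (g : ℕ) hpos)
    constructor
    · exact fun H hh => H h₀ ((hwire g h₁ h₀).2 ⟨e₁, e₂⟩) ((key h₀ ⟨e₁, e₂⟩).2 hh)
    · exact fun H h hw hv => H ((key h ((hwire g h₁ h).1 hw)).1 hv)
  | and φ ψ ih₁ ih₂ =>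
    obtain ⟨i, j, h₁, h₂, h₃⟩ := hg
    rw [Circuit.Value, hkind g h₁, nodeKind]
    have key₁ : ∀ h : Fin (nodeCircuit hl hi₀ q k w.length).size,
        (h : ℕ) / (w.length + k + 1) ^ q = i →
        (h : ℕ) % (w.length + k + 1) ^ q = g % (w.length + k + 1) ^ q →
        ((nodeCircuit hl hi₀ q k w.length).Value w.get h ↔
          φ.Holds k w (digit (w.length + k + 1) g)) := fun h hh hm =>
      (ih₁ hφ.1 h (hh.symm ▸ h₂)).trans
        (BF.holds_congr hφ.1 fun x hx => digit_congr_of_mod hx hm)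
    have key₂ : ∀ h : Fin (nodeCircuit hl hi₀ q k w.length).size,
        (h : ℕ) / (w.length + k + 1) ^ q = j →
        (h : ℕ) % (w.length + k + 1) ^ q = g % (w.length + k + 1) ^ q →
        ((nodeCircuit hl hi₀ q k w.length).Value w.get h ↔
          ψ.Holds k w (digit (w.length + k + 1) g)) := fun h hh hm =>
      (ih₂ hφ.2 h (hh.symm ▸ h₃)).trans
        (BF.holds_congr hφ.2 fun x hx => digit_congr_of_mod hx hm)
    obtain ⟨a, a₁, a₂, -⟩ := hex h₂.lt_length (Nat.mod_lt (g : ℕ) hpos)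
    obtain ⟨b, b₁, b₂, -⟩ := hex h₃.lt_length (Nat.mod_lt (g : ℕ) hpos)
    constructor
    · exact fun H => ⟨(key₁ a a₁ a₂).1 (H a ((hwire g h₁ a).2 ⟨Or.inl a₁, a₂⟩)),
        (key₂ b b₁ b₂).1 (H b ((hwire g h₁ b).2 ⟨Or.inr b₁, b₂⟩))⟩
    · intro H h hw
      obtain ⟨hh | hh, hm⟩ := (hwire g h₁ h).1 hw
      · exact (key₁ h hh hm).2 H.1
      · exact (key₂ h hh hm).2 H.2
  | ex x φ ih =>
    obtain ⟨j, h₁, h₂⟩ := hg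
    rw [Circuit.Value, hkind g h₁, nodeKind]
    have hlt : ∀ m y, digit (w.length + k + 1) m y < w.length + k + 1 := fun m y =>
      Nat.mod_lt _ (Nat.succ_pos _)
    have key : ∀ (h : Fin (nodeCircuit hl hi₀ q k w.length).size) (a : ℕ),
        (h : ℕ) / (w.length + k + 1) ^ q = j →
        (∀ y < q, digit (w.length + k + 1) h y =
          Function.update (digit (w.length + k + 1) g) x a y) →
        ((nodeCircuit hl hi₀ q k w.length).Value w.get h ↔
          φ.Holds k w (Function.update (digit (w.length + k + 1) g) x a)) := fun h a hh hm =>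
      (ih hφ.2 h (hh.symm ▸ h₂)).trans (BF.holds_congr hφ.2 hm)
    constructor
    · rintro ⟨h, hw, hv⟩
      obtain ⟨hh, hm⟩ := (hwire g h₁ h).1 hw
      refine ⟨digit (w.length + k + 1) h x, hlt _ _, (key h _ hh fun y hy => ?_).1 hv⟩
      by_cases hyx : y = x
      · subst hyx; simp
      · rw [Function.update_of_ne hyx]
        exact (hm y (List.mem_range.2 hy)).resolve_left hyx
    · rintro ⟨a, ha, hv⟩
      obtain ⟨m, hm, hmd⟩ := exists_digits (b := w.length + k + 1) (q := q)
        (Function.update (digit (w.length + k + 1) g) x a) fun y _ => by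
          by_cases hyx : y = x
          · subst hyx; simpa using ha
          · rw [Function.update_of_ne hyx]; exact hlt _ _
      obtain ⟨h, e₁, -, e₃⟩ := hex h₂.lt_length hm
      have e₄ : ∀ y < q, digit (w.length + k + 1) h y =
          Function.update (digit (w.length + k + 1) g) x a y :=
        fun y hy => (e₃ y hy).trans (hmd y hy)
      refine ⟨h, (hwire g h₁ h).2 ⟨e₁, fun y hy => ?_⟩, (key h a e₁ e₄).2 hv⟩
      by_cases hyx : y = x
      · exact Or.inl hyx
      · right
        rw [e₄ y (List.mem_range.1 hy), Function.update_of_ne hyx]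

/-! ### Uniformity -/

theorem eval_digitE (ρ : ℕ → ℕ) (r x : ℕ) :
    (digitE k r x).eval ρ = digit (ρ 0 + k + 1) (ρ r) x := by
  simp [digitE, baseE, digit, add_assoc]

theorem eval_nodeE (ρ : ℕ → ℕ) (r : ℕ) :
    (nodeE q k r).eval ρ = ρ r / (ρ 0 + k + 1) ^ q := by
  simp [nodeE, baseE, add_assoc]

theorem eval_codeE (ρ : ℕ → ℕ) (r : ℕ) :
    (codeE q k r).eval ρ = ρ r % (ρ 0 + k + 1) ^ q := by
  simp [codeE, baseE, add_assoc]

theorem eval_gateE (ρ : ℕ → ℕ) (e : Ex) :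
    (gateE k e).eval ρ = e.eval (regs (ρ 0) (digit (ρ 0 + k + 1) (ρ 1))) := by
  rw [gateE, Ex.eval_subst]
  congr 1
  funext r
  cases r with
  | zero => rfl
  | succ x => exact eval_digitE ρ 1 x

open scoped Classical in
theorem eval_nodeWireE (ρ : ℕ → ℕ) (nd : Node) :
    (nodeWireE q k nd).eval ρ = if NodeWire q k (ρ 0) (ρ 1) (ρ 2) nd then 1 else 0 := by
  cases nd with
  | cond e => simp [nodeWireE, NodeWire]
  | bit e => simp [nodeWireE, NodeWire]
  | not i =>
    simp only [nodeWireE, NodeWire, Ex.eval_mul, Ex.eval_eq, Ex.eval_const, eval_nodeE, eval_codeE]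
    split_ifs <;> simp_all
  | and i j =>
    simp only [nodeWireE, NodeWire, Ex.eval_mul, Ex.eval_eq, Ex.eval_const, eval_nodeE, eval_codeE,
      Ex.eval_ite]
    split_ifs <;> simp_all
  | ex x i =>
    simp only [nodeWireE, NodeWire, Ex.eval_mul, Ex.eval_eq, Ex.eval_const, eval_nodeE]
    rw [Ex.eval_prod (P := fun y =>
      y = x ∨ digit (ρ 0 + k + 1) (ρ 2) y = digit (ρ 0 + k + 1) (ρ 1) y)]
    · split_ifs <;> simp_all
    · intro y _
      by_cases h : y = x
      · simp [h]
      · simp [h, eval_digitE]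

open scoped Classical in
theorem eval_wireE (ρ : ℕ → ℕ) :
    (wireE l q k).eval ρ = if Wire l q k (ρ 0) (ρ 1) (ρ 2) then 1 else 0 := by
  rw [wireE, Ex.eval_select, eval_nodeE, Wire]
  rcases h : l[ρ 1 / (ρ 0 + k + 1) ^ q]? with _ | nd
  · simp
  · simp [eval_nodeWireE]

theorem eval_kindE (ρ : ℕ → ℕ) {nd : Node} (h : l[ρ 1 / (ρ 0 + k + 1) ^ q]? = some nd) :
    (kindE l q k).eval ρ = (gateKind l q k (ρ 0) (ρ 1)).code := by
  rw [kindE, Ex.eval_select, eval_nodeE, gateKind, h, Option.elim_some, Option.elim_some]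
  cases nd with
  | cond e =>
    simp only [nodeKindE, nodeKind, Ex.eval_ite, eval_gateE, Ex.eval_const]
    split_ifs <;> rfl
  | bit e =>
    simp only [nodeKindE, nodeKind, Ex.eval_ite, eval_gateE, Ex.eval_const, Ex.eval_sub,
      Ex.eval_add, Ex.eval_reg]
    by_cases h : e.eval (regs (ρ 0) (digit (ρ 0 + k + 1) (ρ 1))) < ρ 0
    · rw [dif_pos h, if_pos (Nat.sub_ne_zero_of_lt h)]
      rfl
    · rw [dif_neg h, if_neg (by lia)]
      rfl
  | not i => rfl
  | and i j => rfl
  | ex x i => rfl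

theorem regsLT_pow_baseE (x : ℕ) : (Ex.pow (baseE k) x).RegsLT 3 :=
  Ex.RegsLT.pow (a := baseE k) ⟨show 0 < 3 by decide, trivial⟩ x

theorem regsLT_digitE {r : ℕ} (hr : r < 3) (x : ℕ) : (digitE k r x).RegsLT 3 :=
  ⟨⟨hr, regsLT_pow_baseE x⟩, show 0 < 3 by decide, trivial⟩

theorem regsLT_nodeE {r : ℕ} (hr : r < 3) : (nodeE q k r).RegsLT 3 :=
  ⟨hr, regsLT_pow_baseE q⟩

theorem regsLT_codeE {r : ℕ} (hr : r < 3) : (codeE q k r).RegsLT 3 :=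
  ⟨hr, regsLT_pow_baseE q⟩

theorem regsLT_gateE (e : Ex) : (gateE k e).RegsLT 3 := by
  refine Ex.RegsLT.subst (fun r => ?_) e
  cases r with
  | zero => exact (by decide : 0 < 3)
  | succ x => exact regsLT_digitE (by decide) x

theorem regsLT_wireE : (wireE l q k).RegsLT 3 := by
  refine Ex.RegsLT.select (fun nd _ => ?_) (regsLT_nodeE (by decide))
  have hc : ((codeE q k 2).eq (codeE q k 1)).RegsLT 3 :=
    .eq (regsLT_codeE (by decide)) (regsLT_codeE (by decide))
  have hn : ∀ i, ((nodeE q k 2).eq (.const i)).RegsLT 3 := fun i =>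
    .eq (regsLT_nodeE (by decide)) trivial
  cases nd with
  | cond e => trivial
  | bit e => trivial
  | not i => exact ⟨hn i, hc⟩
  | and i j => exact ⟨.ite (hn i) trivial (hn j), hc⟩
  | ex x i =>
    refine ⟨hn i, .prod fun y _ => ?_⟩
    split_ifs
    · trivial
    · exact .eq (regsLT_digitE (by decide) y) (regsLT_digitE (by decide) y)

theorem regsLT_kindE : (kindE l q k).RegsLT 3 := by
  refine Ex.RegsLT.select (fun nd _ => ?_) (regsLT_nodeE (by decide))
  cases nd with
  | cond e => exact .ite (regsLT_gateE e) trivial trivial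
  | bit e => exact .ite ⟨show 0 < 3 by decide, regsLT_gateE e⟩ ⟨regsLT_gateE e, trivial⟩ trivial
  | not i => trivial
  | and i j => trivial
  | ex x i => trivial

theorem size_pow_le (a c : ℕ) : (a ^ c).size ≤ c * a.size + 1 := by
  induction c with
  | zero => simp
  | succ c ih =>
    rw [pow_succ]
    have := Ex.size_mul_le (a ^ c) a
    rw [add_mul]
    lia

theorem exists_size_le (c : ℕ) :
    ∃ d, ∀ n m : ℕ, m ≤ c * (n + 1) ^ c → m.size ≤ d * (n.size + 1) := by
  refine ⟨c.size + c + c + 1, fun n m h => ?_⟩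
  have h₁ := Nat.size_le_size h
  have h₂ := Ex.size_mul_le c ((n + 1) ^ c)
  have h₃ := size_pow_le (n + 1) c
  have h₄ := Ex.size_add_le n 1
  rw [Nat.size_one] at h₄
  have h₅ : c * (n + 1).size ≤ c * (n.size + 1 + 1) := Nat.mul_le_mul_left c h₄
  nlinarith [Nat.zero_le (c.size * n.size), Nat.zero_le (c * n.size)]

theorem nodeCircuit_size_le (l : List Node) (q k n : ℕ) :
    l.length * (n + k + 1) ^ q ≤ (l.length * (k + 1) ^ q + q) * (n + 1) ^
      (l.length * (k + 1) ^ q + q) := by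
  have h₁ : n + k + 1 ≤ (k + 1) * (n + 1) := by nlinarith
  calc l.length * (n + k + 1) ^ q ≤ l.length * ((k + 1) * (n + 1)) ^ q :=
        Nat.mul_le_mul_left _ (Nat.pow_le_pow_left h₁ q)
    _ = l.length * (k + 1) ^ q * (n + 1) ^ q := by rw [mul_pow, mul_assoc]
    _ ≤ _ := Nat.mul_le_mul (Nat.le_add_right _ _)
        (Nat.pow_le_pow_right (Nat.succ_pos n) (Nat.le_add_left _ _))

theorem exists_computes {e : Ex} (he : e.RegsLT 3) (d : ℕ) :
    ∃ c, ∀ (n : ℕ) (inputs : List ℕ), (∀ x ∈ inputs, x.size ≤ d * (n.size + 1)) →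
      ∀ c' ≥ c, e.prog.Computes (c' * (n.size + 1)) inputs (e.eval fun r => inputs.getD r 0) := by
  obtain ⟨c, hc⟩ := Ex.computes_prog he
  refine ⟨c * (d + 1), fun n inputs hin c' hc' => ?_⟩
  obtain ⟨s, hs, h₀⟩ := hc inputs _ hin
  refine ⟨s, hs.mono ?_, h₀⟩
  calc c * (d * (n.size + 1) + 1) ≤ c * ((d + 1) * (n.size + 1)) :=
        Nat.mul_le_mul_left c (by rw [add_mul]; lia)
    _ = c * (d + 1) * (n.size + 1) := (mul_assoc ..).symm
    _ ≤ _ := Nat.mul_le_mul_right _ hc'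

theorem logspaceUniform_nodeCircuit (hl : Ordered l) {i : ℕ} (hi : i < l.length) :
    LogspaceUniform (nodeCircuit hl hi q k) := by
  have hsize : Ex.RegsLT 3 (.mul (.const l.length) (.pow (baseE k) q)) :=
    ⟨trivial, regsLT_pow_baseE q⟩
  have hout : Ex.RegsLT 3 (.mul (.const i) (.pow (baseE k) q)) :=
    ⟨trivial, regsLT_pow_baseE q⟩
  obtain ⟨d, hd⟩ := exists_size_le (l.length * (k + 1) ^ q + q)
  have hgate : ∀ n (g : Fin (nodeCircuit hl hi q k n).size),
      (g : ℕ).size ≤ (d + 1) * (n.size + 1) := fun n g =>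
    (hd n g (g.2.le.trans (nodeCircuit_size_le l q k n))).trans
      (Nat.mul_le_mul_right _ (Nat.le_succ d))
  have hn : ∀ n : ℕ, n.size ≤ (d + 1) * (n.size + 1) := fun n => by nlinarith
  obtain ⟨c₁, h₁⟩ := exists_computes hsize (d + 1)
  obtain ⟨c₂, h₂⟩ := exists_computes hout (d + 1)
  obtain ⟨c₃, h₃⟩ := exists_computes (regsLT_kindE (l := l) (q := q) (k := k)) (d + 1)
  obtain ⟨c₄, h₄⟩ := exists_computes (regsLT_wireE (l := l) (q := q) (k := k)) (d + 1)
  refine ⟨Ex.prog (.mul (.const l.length) (.pow (baseE k) q)),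
    Ex.prog (.mul (.const i) (.pow (baseE k) q)), Ex.prog (kindE l q k), Ex.prog (wireE l q k),
    c₁ + c₂ + c₃ + c₄, fun n => ⟨?_, ?_, fun g => ?_, fun g h => ?_⟩⟩
  · convert h₁ n [n] (by simpa using hn n) (c₁ + c₂ + c₃ + c₄) (by lia) using 1
    simp [baseE, nodeCircuit, add_assoc]
  · convert h₂ n [n] (by simpa using hn n) (c₁ + c₂ + c₃ + c₄) (by lia) using 1
    simp [baseE, nodeCircuit, add_assoc]
  · convert h₃ n [n, g] (by simpa using ⟨hn n, hgate n g⟩) (c₁ + c₂ + c₃ + c₄) (by lia) using 1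
    exact (eval_kindE (fun r => [n, (g : ℕ)].getD r 0)
      (List.getElem?_eq_getElem (node_lt_length (q := q) (k := k) (n := n) g))).symm
  · convert h₄ n [n, g, h] (by simpa using ⟨hn n, hgate n g, hgate n h⟩) (c₁ + c₂ + c₃ + c₄) (by lia) using 1
    rw [eval_wireE]
    by_cases hw : Wire l q k n g h
    · rw [(nodeCircuit_wire hl hi g h).2 hw]
      exact (if_pos hw).symm
    · rw [Bool.eq_false_iff.2 (mt (nodeCircuit_wire hl hi g h).1 hw)]
      exact (if_neg hw).symm

/-- Languages that are definable in bounded arithmetic are in AC⁰. -/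
theorem BF.inAC0 (φ : BF) (k : ℕ) : InAC0 {w | φ.Holds k w fun _ => 0} := by
  obtain ⟨q, hq⟩ := φ.exists_varsLT
  obtain ⟨l, i, hl, hi⟩ := exists_represents φ [] fun i nd h => by simp at h
  rw [List.nil_append] at hl hi
  refine ⟨nodeCircuit hl hi.lt_length q k, l.length * (k + 1) ^ q + q, l.length,
    nodeCircuit_size_le l q k, nodeCircuit_depthLE hl hi.lt_length,
    logspaceUniform_nodeCircuit hl hi.lt_length, fun w => ?_⟩
  have hpos : 0 < (w.length + k + 1) ^ q := pow_pos (Nat.succ_pos _) q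
  have hout : ((nodeCircuit hl hi.lt_length q k w.length).out : ℕ) =
    i * (w.length + k + 1) ^ q + 0 := rfl
  rw [Circuit.Accepts, value_nodeCircuit hl hi.lt_length w φ hq _
    (by rw [hout, mul_add_div_of_lt hpos]; exact hi)]
  refine BF.holds_congr hq fun x hx => ?_
  rw [hout, digit_mul_pow_add _ _ _ _ _ hx]
  simp [digit]

end Correctness

end CQA

namespace CQA

/-! ### Definability in bounded arithmetic -/

/-- The assignment with the value `N` for variable `0`, the values `y` for the odd variables and
the values `s` for the even positive ones. -/
def join (N : ℕ) (y s : ℕ → ℕ) : ℕ → ℕ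
  | 0 => N
  | j + 1 => if j % 2 = 0 then y (j / 2) else s (j / 2)

@[simp] theorem join_zero (N : ℕ) (y s : ℕ → ℕ) : join N y s 0 = N := rfl

@[simp] theorem join_odd (N : ℕ) (y s : ℕ → ℕ) (i : ℕ) : join N y s (2 * i + 1) = y i := by
  simp [join]

@[simp] theorem join_even (N : ℕ) (y s : ℕ → ℕ) (i : ℕ) : join N y s (2 * i + 2) = s i := by
  have h₁ : (2 * i + 1) % 2 = 1 := by lia
  have h₂ : (2 * i + 1) / 2 = i := by lia
  simp [join, h₁, h₂]

theorem eq_zero_or_odd_or_even (j : ℕ) : j = 0 ∨ (∃ i, j = 2 * i + 1) ∨ ∃ i, j = 2 * i + 2 := by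
  rcases j with _ | j
  · simp
  · rcases Nat.even_or_odd' j with ⟨i, rfl | rfl⟩
    · exact Or.inr (Or.inl ⟨i, rfl⟩)
    · exact Or.inr (Or.inr ⟨i, rfl⟩)

theorem join_update_zero (N N' : ℕ) (y s : ℕ → ℕ) :
    Function.update (join N y s) 0 N' = join N' y s := by
  funext j
  rcases j with _ | j
  · simp
  · simp [join]

theorem join_update_odd (N : ℕ) (y s : ℕ → ℕ) (i a : ℕ) :
    Function.update (join N y s) (2 * i + 1) a = join N (Function.update y i a) s := by
  funext j
  rcases eq_zero_or_odd_or_even j with rfl | ⟨m, rfl⟩ | ⟨m, rfl⟩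
  · rw [Function.update_of_ne (by lia)]; simp
  · by_cases h : m = i
    · subst h; simp
    · rw [Function.update_of_ne (by lia)]; simp [h]
  · rw [Function.update_of_ne (by lia)]; simp

theorem join_update_even (N : ℕ) (y s : ℕ → ℕ) (i a : ℕ) :
    Function.update (join N y s) (2 * i + 2) a = join N y (Function.update s i a) := by
  funext j
  rcases eq_zero_or_odd_or_even j with rfl | ⟨m, rfl⟩ | ⟨m, rfl⟩
  · rw [Function.update_of_ne (by lia)]; simp
  · rw [Function.update_of_ne (by lia)]; simp
  · by_cases h : m = i
    · subst h; simp
    · rw [Function.update_of_ne (by lia)]; simp [h]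

/-- A function of the length of the bit string and of the assignment that is given by an
arithmetic expression. -/
def ExprDef (f : ℕ → ℕ → (ℕ → ℕ) → (ℕ → ℕ) → ℕ) : Prop :=
  ∃ e : Ex, ∀ n N y s, e.eval (regs n (join N y s)) = f n N y s

namespace ExprDef

variable {f g : ℕ → ℕ → (ℕ → ℕ) → (ℕ → ℕ) → ℕ}

theorem const (c : ℕ) : ExprDef fun _ _ _ _ => c := ⟨.const c, fun _ _ _ _ => rfl⟩

theorem length : ExprDef fun n _ _ _ => n := ⟨.reg 0, fun _ _ _ _ => rfl⟩

theorem base : ExprDef fun _ N _ _ => N := ⟨.reg 1, fun _ _ _ _ => rfl⟩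

theorem odd (i : ℕ) : ExprDef fun _ _ y _ => y i :=
  ⟨.reg (2 * i + 2), fun _ N y s => join_odd N y s i⟩

theorem even (i : ℕ) : ExprDef fun _ _ _ s => s i :=
  ⟨.reg (2 * i + 3), fun _ N y s => join_even N y s i⟩

theorem add (hf : ExprDef f) (hg : ExprDef g) : ExprDef fun n N y s => f n N y s + g n N y s := by
  obtain ⟨a, ha⟩ := hf
  obtain ⟨b, hb⟩ := hg
  exact ⟨.add a b, fun n N y s => by simp [ha, hb]⟩

theorem mul (hf : ExprDef f) (hg : ExprDef g) : ExprDef fun n N y s => f n N y s * g n N y s := by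
  obtain ⟨a, ha⟩ := hf
  obtain ⟨b, hb⟩ := hg
  exact ⟨.mul a b, fun n N y s => by simp [ha, hb]⟩

theorem pow (hf : ExprDef f) (m : ℕ) : ExprDef fun n N y s => f n N y s ^ m := by
  obtain ⟨a, ha⟩ := hf
  exact ⟨.pow a m, fun n N y s => by simp [ha]⟩

theorem sum {α : Type*} (t : Finset α) {f : α → ℕ → ℕ → (ℕ → ℕ) → (ℕ → ℕ) → ℕ}
    (hf : ∀ a, ExprDef (f a)) : ExprDef fun n N y s => ∑ a ∈ t, f a n N y s := by
  classical
  induction t using Finset.induction_on with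
  | empty => simpa using const 0
  | insert a t ha ih => simpa only [Finset.sum_insert ha] using (hf a).add ih

end ExprDef

/-- A property of a bit string and an assignment that is defined by a formula, provided that the
value of variable `0` is in the range of the quantifiers. -/
def Definable (k : ℕ) (Q : List Bool → ℕ → (ℕ → ℕ) → (ℕ → ℕ) → Prop) : Prop :=
  ∃ φ : BF, ∀ w N y s, N < w.length + k + 1 → (φ.Holds k w (join N y s) ↔ Q w N y s)

namespace Definable

variable {k : ℕ} {P Q : List Bool → ℕ → (ℕ → ℕ) → (ℕ → ℕ) → Prop}

theorem congr (hP : Definable k P) (h : ∀ w N y s, P w N y s ↔ Q w N y s) : Definable k Q := by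
  obtain ⟨φ, hφ⟩ := hP
  exact ⟨φ, fun w N y s hN => (hφ w N y s hN).trans (h w N y s)⟩

theorem not (hP : Definable k P) : Definable k fun w N y s => ¬ P w N y s := by
  obtain ⟨φ, hφ⟩ := hP
  exact ⟨.not φ, fun w N y s hN => not_congr (hφ w N y s hN)⟩

theorem and (hP : Definable k P) (hQ : Definable k Q) :
    Definable k fun w N y s => P w N y s ∧ Q w N y s := by
  obtain ⟨φ, hφ⟩ := hP
  obtain ⟨ψ, hψ⟩ := hQ
  exact ⟨.and φ ψ, fun w N y s hN => and_congr (hφ w N y s hN) (hψ w N y s hN)⟩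

theorem or (hP : Definable k P) (hQ : Definable k Q) :
    Definable k fun w N y s => P w N y s ∨ Q w N y s :=
  (hP.not.and hQ.not).not.congr fun w N y s => by tauto

theorem imp (hP : Definable k P) (hQ : Definable k Q) :
    Definable k fun w N y s => P w N y s → Q w N y s :=
  (hP.and hQ.not).not.congr fun w N y s => by tauto

theorem const (p : Prop) : Definable k fun _ _ _ _ => p := by
  by_cases h : p
  · exact ⟨.cond (.const 1), fun w N y s _ => by simp [BF.Holds, h]⟩
  · exact ⟨.cond (.const 0), fun w N y s _ => by simp [BF.Holds, h]⟩

theorem eq {f g : ℕ → ℕ → (ℕ → ℕ) → (ℕ → ℕ) → ℕ} (hf : ExprDef f) (hg : ExprDef g) :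
    Definable k fun w N y s => f w.length N y s = g w.length N y s := by
  obtain ⟨a, ha⟩ := hf
  obtain ⟨b, hb⟩ := hg
  exact ⟨.cond (.eq a b), fun w N y s _ => by simp [BF.Holds, ha, hb]⟩

theorem lt {f g : ℕ → ℕ → (ℕ → ℕ) → (ℕ → ℕ) → ℕ} (hf : ExprDef f) (hg : ExprDef g) :
    Definable k fun w N y s => f w.length N y s < g w.length N y s := by
  obtain ⟨a, ha⟩ := hf
  obtain ⟨b, hb⟩ := hg
  exact ⟨.cond (.sub b a), fun w N y s _ => by simp [BF.Holds, ha, hb, Nat.sub_eq_zero_iff_le]⟩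

theorem bit {f : ℕ → ℕ → (ℕ → ℕ) → (ℕ → ℕ) → ℕ} (hf : ExprDef f) :
    Definable k fun w N y s => w[f w.length N y s]? = some true := by
  obtain ⟨a, ha⟩ := hf
  exact ⟨.bit a, fun w N y s _ => by simp only [BF.Holds, ha]⟩

theorem ball {α : Type*} (l : List α) {P : α → List Bool → ℕ → (ℕ → ℕ) → (ℕ → ℕ) → Prop}
    (h : ∀ a ∈ l, Definable k (P a)) : Definable k fun w N y s => ∀ a ∈ l, P a w N y s := by
  induction l with
  | nil => simpa using const True
  | cons a l ih =>
    simpa only [List.forall_mem_cons] using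
      (h a (by simp)).and (ih fun b hb => h b (by simp [hb]))

theorem bex {α : Type*} (l : List α) {P : α → List Bool → ℕ → (ℕ → ℕ) → (ℕ → ℕ) → Prop}
    (h : ∀ a ∈ l, Definable k (P a)) : Definable k fun w N y s => ∃ a ∈ l, P a w N y s :=
  (ball l fun a ha => (h a ha).not).not.congr fun w N y s => by push Not; rfl

theorem exists_base (hP : Definable k P) :
    Definable k fun w _ y s => ∃ N < w.length + k + 1, P w N y s := by
  obtain ⟨φ, hφ⟩ := hP
  refine ⟨.ex 0 φ, fun w N y s _ => exists_congr fun a => and_congr_right fun ha => ?_⟩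
  rw [join_update_zero]
  exact hφ w a y s ha

theorem exists_even (hP : Definable k P) (x : ℕ) :
    Definable k fun w N y s => ∃ a < N, P w N y (Function.update s x a) := by
  obtain ⟨φ, hφ⟩ := (lt (.even x) .base).and hP
  beta_reduce at hφ
  refine ⟨.ex (2 * x + 2) φ, fun w N y s hN => ?_⟩
  constructor
  · rintro ⟨a, ha, h⟩
    rw [join_update_even] at h
    have := (hφ w N y _ hN).1 h
    rw [Function.update_self] at this
    exact ⟨a, this⟩
  · rintro ⟨a, ha, h⟩
    refine ⟨a, ha.trans hN, ?_⟩
    rw [join_update_even]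
    exact (hφ w N y _ hN).2 ⟨by rwa [Function.update_self], h⟩

theorem exists_odd (hP : Definable k P) (x : ℕ) :
    Definable k fun w N y s => ∃ a < N, P w N (Function.update y x a) s := by
  obtain ⟨φ, hφ⟩ := (lt (.odd x) .base).and hP
  beta_reduce at hφ
  refine ⟨.ex (2 * x + 1) φ, fun w N y s hN => ?_⟩
  constructor
  · rintro ⟨a, ha, h⟩
    rw [join_update_odd] at h
    have := (hφ w N _ s hN).1 h
    rw [Function.update_self] at this
    exact ⟨a, this⟩
  · rintro ⟨a, ha, h⟩
    refine ⟨a, ha.trans hN, ?_⟩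
    rw [join_update_odd]
    exact (hφ w N _ s hN).2 ⟨by rwa [Function.update_self], h⟩

end Definable

/-- `s'` results from `s` by giving the variables in `V` some values less than `N`. -/
def Variant (V : Finset ℕ) (N : ℕ) (s s' : ℕ → ℕ) : Prop :=
  (∀ x ∈ V, s' x < N) ∧ ∀ x ∉ V, s' x = s x

theorem exists_variant_empty (N : ℕ) (s : ℕ → ℕ) (P : (ℕ → ℕ) → Prop) :
    (∃ s', Variant ∅ N s s' ∧ P s') ↔ P s := by
  constructor
  · rintro ⟨s', h, hP⟩
    have : s' = s := funext fun x => h.2 x (Finset.notMem_empty x)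
    exact this ▸ hP
  · exact fun h => ⟨s, ⟨by simp, fun _ _ => rfl⟩, h⟩

theorem exists_variant_insert {V : Finset ℕ} {x : ℕ} (hx : x ∉ V) (N : ℕ) (s : ℕ → ℕ)
    (P : (ℕ → ℕ) → Prop) :
    (∃ s', Variant (insert x V) N s s' ∧ P s') ↔
      ∃ a < N, ∃ s', Variant V N (Function.update s x a) s' ∧ P s' := by
  constructor
  · rintro ⟨s', h, hP⟩
    refine ⟨s' x, h.1 x (Finset.mem_insert_self x V), s',
      ⟨fun z hz => h.1 z (Finset.mem_insert_of_mem hz), fun z hz => ?_⟩, hP⟩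
    by_cases hzx : z = x
    · subst hzx; simp
    · rw [Function.update_of_ne hzx, h.2 z (by simp [hzx, hz])]
  · rintro ⟨a, ha, s', h, hP⟩
    refine ⟨s', ⟨fun z hz => ?_, fun z hz => ?_⟩, hP⟩
    · by_cases hzx : z = x
      · subst hzx
        rw [h.2 z hx, Function.update_self]
        exact ha
      · exact h.1 z (Finset.mem_of_mem_insert_of_ne hz hzx)
    · rw [Finset.mem_insert, not_or] at hz
      rw [h.2 z hz.2, Function.update_of_ne hz.1]

namespace Definable

variable {k : ℕ} {P : List Bool → ℕ → (ℕ → ℕ) → (ℕ → ℕ) → Prop}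

theorem exists_variant_even (hP : Definable k P) (V : Finset ℕ) :
    Definable k fun w N y s => ∃ s', Variant V N s s' ∧ P w N y s' := by
  induction V using Finset.induction_on with
  | empty => simpa only [exists_variant_empty] using hP
  | insert x V hx ih => simpa only [exists_variant_insert hx] using ih.exists_even x

theorem exists_variant_odd (hP : Definable k P) (V : Finset ℕ) :
    Definable k fun w N y s => ∃ y', Variant V N y y' ∧ P w N y' s := by
  induction V using Finset.induction_on with
  | empty =>
    simpa only [fun w N y s => exists_variant_empty N y fun y' => P w N y' s] using hP
  | insert x V hx ih =>
    exact (ih.exists_odd x).congr fun w N y s =>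
      (exists_variant_insert hx N y fun y' => P w N y' s).symm

theorem forall_variant_even (hP : Definable k P) (V : Finset ℕ) :
    Definable k fun w N y s => ∀ s', Variant V N s s' → P w N y s' :=
  (hP.not.exists_variant_even V).not.congr fun w N y s => by push Not; rfl

theorem forall_variant_odd (hP : Definable k P) (V : Finset ℕ) :
    Definable k fun w N y s => ∀ y', Variant V N y y' → P w N y' s :=
  (hP.not.exists_variant_odd V).not.congr fun w N y s => by push Not; rfl

end Definable

end CQA

namespace CQA

universe u v

section Encoding

variable {S : Sig.{u}} {C : Type v}

/-- The number of bits for the relations of a list of predicates over `N` constants. -/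
def relLen (ps : List S.Pred) (N : ℕ) : ℕ := (ps.map fun p => N ^ S.arity p).sum

open scoped Classical in
/-- The number of bits before those of the relation of `p`. -/
noncomputable def offset (p : S.Pred) (N : ℕ) : List S.Pred → ℕ
  | [] => 0
  | q :: ps => if q = p then 0 else N ^ S.arity q + offset p N ps

/-- The number of a tuple, as a numeral in base `N`. -/
def tupleCode (N : ℕ) {a : ℕ} (t : Fin a → ℕ) : ℕ := ∑ i, t i * N ^ (i : ℕ)

theorem length_encodePred (dom : List C) (D : Set (Fact S C)) (p : S.Pred) :
    (encodePred dom D p).length = dom.length ^ S.arity p := by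
  simp [encodePred]

theorem length_flatMap_encodePred (dom : List C) (D : Set (Fact S C)) (ps : List S.Pred) :
    (ps.flatMap (encodePred dom D)).length = relLen ps dom.length := by
  simp [List.length_flatMap, relLen, length_encodePred]

theorem tupleCode_eq (N : ℕ) {a : ℕ} (t : Fin a → Fin N) :
    tupleCode N (fun i => (t i : ℕ)) = finFunctionFinEquiv t :=
  (finFunctionFinEquiv_apply t).symm

open scoped Classical in
theorem getElem?_encodePred (dom : List C) (D : Set (Fact S C)) (p : S.Pred)
    (t : Fin (S.arity p) → Fin dom.length) :
    (encodePred dom D p)[tupleCode dom.length fun i => (t i : ℕ)]? =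
      some (decide (Fact.mk p (fun i => dom.get (t i)) ∈ D)) := by
  rw [tupleCode_eq, encodePred, List.getElem?_ofFn, dif_pos (Fin.is_lt _)]
  simp only [Fin.eta, Equiv.symm_apply_apply]

open scoped Classical in
theorem getElem?_flatMap_encodePred (dom : List C) (D : Set (Fact S C)) (ps : List S.Pred)
    (p : S.Pred) (hp : p ∈ ps) (t : Fin (S.arity p) → Fin dom.length) :
    (ps.flatMap (encodePred dom D))[offset p dom.length ps +
      tupleCode dom.length fun i => (t i : ℕ)]? =
      some (decide (Fact.mk p (fun i => dom.get (t i)) ∈ D)) := by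
  induction ps with
  | nil => cases hp
  | cons q ps ih =>
    rw [List.flatMap_cons, offset]
    by_cases h : q = p
    · subst h
      rw [if_pos rfl, zero_add, List.getElem?_append_left, getElem?_encodePred]
      rw [length_encodePred, tupleCode_eq]
      exact Fin.is_lt _
    · rw [if_neg h, List.getElem?_append_right, length_encodePred, add_assoc,
        Nat.add_sub_cancel_left]
      · exact ih ((List.mem_cons.1 hp).resolve_left fun e => h e.symm)
      · rw [length_encodePred, add_assoc]
        exact Nat.le_add_right _ _

theorem encodePred_congr (dom : List C) {D E : Set (Fact S C)} {p : S.Pred}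
    (h : ∀ f : Fact S C, f.pred = p → (f ∈ D ↔ f ∈ E)) :
    encodePred dom D p = encodePred dom E p := by
  unfold encodePred
  congr 1
  funext k
  rw [decide_eq_decide]
  exact h _ rfl

/-- Each bit array encodes a relation. -/
theorem exists_encodePred_eq (dom : List C) (hdom : dom.Nodup) (p : S.Pred) (w : List Bool)
    (hw : w.length = dom.length ^ S.arity p) :
    ∃ D : Set (Fact S C), (∀ f ∈ D, f.pred = p ∧ ∀ i, f.args i ∈ dom) ∧
      encodePred dom D p = w := by
  refine ⟨{f | ∃ k : Fin (dom.length ^ S.arity p), w[(k : ℕ)]? = some true ∧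
    f = ⟨p, fun i => dom.get (finFunctionFinEquiv.symm k i)⟩}, ?_, ?_⟩
  · rintro _ ⟨k, _, rfl⟩
    exact ⟨rfl, fun i => List.get_mem _ _⟩
  · refine List.ext_getElem (by rw [length_encodePred, hw]) fun i h₁ h₂ => ?_
    simp only [encodePred, List.getElem_ofFn, Set.mem_ofPred_eq]
    rw [Bool.eq_iff_iff, @decide_eq_true_iff _ (Classical.propDecidable _)]
    constructor
    · rintro ⟨k, hk, he⟩
      have he' := eq_of_heq (Fact.mk.inj he).2
      have : finFunctionFinEquiv.symm (⟨i, hw ▸ h₂⟩ : Fin (dom.length ^ S.arity p)) =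
          finFunctionFinEquiv.symm k :=
        funext fun j => List.nodup_iff_injective_get.1 hdom (congrFun he' j)
      have hik := finFunctionFinEquiv.symm.injective this
      rw [← hik, List.getElem?_eq_getElem h₂, Option.some.injEq] at hk
      exact hk
    · intro h
      exact ⟨⟨i, hw ▸ h₂⟩, by rw [List.getElem?_eq_getElem h₂, h], rfl⟩

theorem exists_flatMap_encodePred_eq (dom : List C) (hdom : dom.Nodup) (ps : List S.Pred)
    (hps : ps.Nodup) (w : List Bool) (hw : w.length = relLen ps dom.length) :
    ∃ D : Set (Fact S C), (∀ f ∈ D, f.pred ∈ ps ∧ ∀ i, f.args i ∈ dom) ∧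
      ps.flatMap (encodePred dom D) = w := by
  induction ps generalizing w with
  | nil =>
    refine ⟨∅, fun f hf => hf.elim, ?_⟩
    rw [List.flatMap_nil, List.eq_nil_of_length_eq_zero hw]
  | cons p ps ih =>
    rw [List.nodup_cons] at hps
    have hw' : w.length = dom.length ^ S.arity p + relLen ps dom.length := hw
    obtain ⟨D₁, h₁, e₁⟩ := exists_encodePred_eq dom hdom p (w.take (dom.length ^ S.arity p))
      (by rw [List.length_take, hw']; exact Nat.min_eq_left (Nat.le_add_right _ _))
    obtain ⟨D₂, h₂, e₂⟩ := ih hps.2 (w.drop (dom.length ^ S.arity p))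
      (by rw [List.length_drop, hw', Nat.add_sub_cancel_left])
    refine ⟨D₁ ∪ D₂, ?_, ?_⟩
    · rintro f (hf | hf)
      · exact ⟨by simp [(h₁ f hf).1], (h₁ f hf).2⟩
      · exact ⟨List.mem_cons_of_mem _ (h₂ f hf).1, (h₂ f hf).2⟩
    · rw [List.flatMap_cons, ← List.take_append_drop (dom.length ^ S.arity p) w]
      congr 1
      · rw [← e₁]
        refine encodePred_congr dom fun f hf => or_iff_left fun h => hps.1 ?_
        exact hf ▸ (h₂ f h).1
      · rw [← e₂]
        refine List.flatMap_congr fun q hq => encodePred_congr dom fun f hf => or_iff_right fun h => ?_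
        exact hps.1 ((h₁ f h).1 ▸ hf ▸ hq)

variable (Sg : Finset (Dependency S C))

theorem nodup_dataPreds : (dataPreds Sg).Nodup := by
  classical
  exact (List.nodup_dedup _).filter _

theorem mem_dataPreds {p : S.Pred} : p ∈ dataPreds Sg ↔ p ∈ preds Sg ∧ p ≠ S.bot := by
  classical
  simp [dataPreds]

theorem isDatabaseOver_iff {D : Set (Fact S C)} :
    IsDatabaseOver Sg D ↔ ∀ f ∈ D, f.pred ∈ dataPreds Sg :=
  ⟨fun h f hf => (mem_dataPreds Sg).2 ⟨h.2 f hf, h.1 f hf⟩,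
    fun h => ⟨fun f hf => ((mem_dataPreds Sg).1 (h f hf)).2,
      fun f hf => ((mem_dataPreds Sg).1 (h f hf)).1⟩⟩

theorem nodup_consts : (consts Sg).Nodup := by
  classical
  exact List.nodup_dedup _

theorem length_encode (dom : List C) (D D' : Set (Fact S C)) :
    (encode Sg dom D D').length =
      relLen (dataPreds Sg) dom.length + relLen (dataPreds Sg) dom.length := by
  rw [encode, List.length_append, length_flatMap_encodePred, length_flatMap_encodePred]

theorem exists_encode_eq (dom : List C) (hdom : dom.Nodup) (w : List Bool)
    (hw : relLen (dataPreds Sg) dom.length + relLen (dataPreds Sg) dom.length = w.length)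
    (hc : consts Sg <+: dom) : ∃ D D', IsInstance Sg dom D D' ∧ w = encode Sg dom D D' := by
  obtain ⟨D, h₁, e₁⟩ := exists_flatMap_encodePred_eq dom hdom (dataPreds Sg) (nodup_dataPreds Sg)
    (w.take (relLen (dataPreds Sg) dom.length))
    (by rw [List.length_take, ← hw]; exact Nat.min_eq_left (Nat.le_add_right _ _))
  obtain ⟨D', h₂, e₂⟩ := exists_flatMap_encodePred_eq dom hdom (dataPreds Sg) (nodup_dataPreds Sg)
    (w.drop (relLen (dataPreds Sg) dom.length))
    (by rw [List.length_drop, ← hw, Nat.add_sub_cancel_left])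
  refine ⟨D, D', ⟨hdom, hc, (isDatabaseOver_iff Sg).2 fun f hf => (h₁ f hf).1,
    (isDatabaseOver_iff Sg).2 fun f hf => (h₂ f hf).1, ?_⟩, ?_⟩
  · rintro f (hf | hf)
    · exact (h₁ f hf).2
    · exact (h₂ f hf).2
  · rw [encode, e₁, e₂, List.take_append_drop]

/-- The fact with the predicate `p` and the tuple with the numbers `t` is in the first database. -/
def MainBit (w : List Bool) (N : ℕ) (p : S.Pred) (t : Fin (S.arity p) → ℕ) : Prop :=
  p ∈ dataPreds Sg ∧ w[offset p N (dataPreds Sg) + tupleCode N t]? = some true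

/-- The fact with the predicate `p` and the tuple with the numbers `t` is in the second
database. -/
def AuxBit (w : List Bool) (N : ℕ) (p : S.Pred) (t : Fin (S.arity p) → ℕ) : Prop :=
  p ∈ dataPreds Sg ∧
    w[relLen (dataPreds Sg) N + (offset p N (dataPreds Sg) + tupleCode N t)]? = some true

variable {Sg} {dom : List C} {D D' : Set (Fact S C)}

theorem IsInstance.mainBit_iff (h : IsInstance Sg dom D D') {p : S.Pred}
    (t : Fin (S.arity p) → Fin dom.length) :
    MainBit Sg (encode Sg dom D D') dom.length p (fun i => (t i : ℕ)) ↔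
      Fact.mk p (fun i => dom.get (t i)) ∈ D := by
  classical
  constructor
  · rintro ⟨hp, hb⟩
    have hb' := getElem?_flatMap_encodePred dom D (dataPreds Sg) p hp t
    rw [encode, List.getElem?_append_left (List.getElem?_eq_some_iff.1 hb').1, hb'] at hb
    simpa using hb
  · intro hf
    have hp : p ∈ dataPreds Sg := (isDatabaseOver_iff Sg).1 h.database _ hf
    have hb' := getElem?_flatMap_encodePred dom D (dataPreds Sg) p hp t
    refine ⟨hp, ?_⟩
    rw [encode, List.getElem?_append_left (List.getElem?_eq_some_iff.1 hb').1, hb']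
    simpa using hf

theorem IsInstance.auxBit_iff (h : IsInstance Sg dom D D') {p : S.Pred}
    (t : Fin (S.arity p) → Fin dom.length) :
    AuxBit Sg (encode Sg dom D D') dom.length p (fun i => (t i : ℕ)) ↔
      Fact.mk p (fun i => dom.get (t i)) ∈ D' := by
  classical
  have key : ∀ j, (encode Sg dom D D')[relLen (dataPreds Sg) dom.length + j]? =
      ((dataPreds Sg).flatMap (encodePred dom D'))[j]? := fun j => by
    rw [encode, List.getElem?_append_right, length_flatMap_encodePred, Nat.add_sub_cancel_left]
    rw [length_flatMap_encodePred]
    exact Nat.le_add_right _ _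
  constructor
  · rintro ⟨hp, hb⟩
    rw [key, getElem?_flatMap_encodePred dom D' (dataPreds Sg) p hp t] at hb
    simpa using hb
  · intro hf
    have hp : p ∈ dataPreds Sg := (isDatabaseOver_iff Sg).1 h.database' _ hf
    refine ⟨hp, ?_⟩
    rw [key, getElem?_flatMap_encodePred dom D' (dataPreds Sg) p hp t]
    simpa using hf

/-! ### The number of the listed constants -/

theorem relLen_mono (ps : List S.Pred) : Monotone (relLen ps) := by
  induction ps with
  | nil => exact fun _ _ _ => le_rfl
  | cons p ps ih => exact fun a b h => Nat.add_le_add (Nat.pow_le_pow_left h _) (ih h)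

theorem relLen_strictMono {ps : List S.Pred} (h : ∃ p ∈ ps, S.arity p ≠ 0) :
    StrictMono (relLen ps) := by
  induction ps with
  | nil => simp at h
  | cons p ps ih =>
    intro a b hab
    by_cases hp : S.arity p = 0
    · refine Nat.add_lt_add_of_le_of_lt (Nat.pow_le_pow_left hab.le _) (ih ?_ hab)
      simpa [hp] using h
    · exact Nat.add_lt_add_of_lt_of_le (Nat.pow_lt_pow_left hab hp) (relLen_mono ps hab.le)

theorem IsInstance.restrict (h : IsInstance Sg dom D D')
    (h₀ : ¬ ∃ p ∈ dataPreds Sg, S.arity p ≠ 0) :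
    IsInstance Sg (consts Sg) D D' ∧ encode Sg (consts Sg) D D' = encode Sg dom D D' := by
  push Not at h₀
  constructor
  · refine ⟨nodup_consts Sg, List.prefix_rfl, h.database, h.database', fun f hf i => ?_⟩
    have hp : f.pred ∈ dataPreds Sg :=
      hf.elim ((isDatabaseOver_iff Sg).1 h.database f) ((isDatabaseOver_iff Sg).1 h.database' f)
    exact (Fin.cast (h₀ _ hp) i).elim0
  · have key : ∀ E : Set (Fact S C), (dataPreds Sg).flatMap (encodePred (consts Sg) E) =
        (dataPreds Sg).flatMap (encodePred dom E) := fun E => by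
      refine List.flatMap_congr fun p hp => ?_
      have : IsEmpty (Fin (S.arity p)) := by rw [h₀ p hp]; infer_instance
      refine List.ext_getElem (by rw [length_encodePred, length_encodePred, h₀ p hp]; simp)
        fun i _ _ => ?_
      simp only [encodePred, List.getElem_ofFn]
      rw [decide_eq_decide, Subsingleton.elim (fun i => (consts Sg).get _)]
    rw [encode, encode, key, key]

/-- A list of constants whose length is determined by that of the encoding. -/
theorem IsInstance.exists_canonical (h : IsInstance Sg dom D D') :
    ∃ dom', IsInstance Sg dom' D D' ∧ encode Sg dom' D D' = encode Sg dom D D' ∧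
      dom'.length < (encode Sg dom D D').length + (consts Sg).length + 1 ∧
      ∀ {dom₁ : List C} {D₁ D₁' : Set (Fact S C)}, IsInstance Sg dom₁ D₁ D₁' →
        encode Sg dom₁ D₁ D₁' = encode Sg dom D D' →
          ∃ dom₁', IsInstance Sg dom₁' D₁ D₁' ∧ encode Sg dom₁' D₁ D₁' = encode Sg dom D D' ∧
            dom₁'.length = dom'.length := by
  by_cases h₀ : ∃ p ∈ dataPreds Sg, S.arity p ≠ 0
  · refine ⟨dom, h, rfl, ?_, fun {dom₁ D₁ D₁'} h₁ he => ⟨dom₁, h₁, he, ?_⟩⟩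
    · rw [length_encode]
      have := (relLen_strictMono h₀).id_le dom.length
      simp only [id] at this
      lia
    · have := congrArg List.length he
      rw [length_encode, length_encode] at this
      exact (relLen_strictMono h₀).injective (by lia)
  · refine ⟨consts Sg, (h.restrict h₀).1, (h.restrict h₀).2, by lia, fun {dom₁ D₁ D₁'} h₁ he =>
      ⟨consts Sg, (h₁.restrict h₀).1, (h₁.restrict h₀).2.trans he, rfl⟩⟩

end Encoding

end CQA

namespace CQA

universe u v

section Numbers

variable {S : Sig.{u}} {C : Type v}

theorem Conj.finite_predVars (γ : Conj S C) : γ.predVars.Finite := by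
  have : γ.predVars ⊆ ⋃ a ∈ {a | a ∈ γ.atoms}, Set.range fun i =>
      match a.args i with
      | .var x => x
      | .cst _ => 0 := by
    rintro x ⟨a, ha, i, hi⟩
    refine Set.mem_biUnion ha ⟨i, ?_⟩
    simp only [hi]
  exact (Set.Finite.biUnion γ.atoms.finite_toSet fun a _ => Set.finite_range _).subset this

/-- The variables of the body. -/
noncomputable def Dependency.bodyVars (τ : Dependency S C) : Finset ℕ :=
  (τ.body.finite_predVars.subset τ.body_safe).toFinset

theorem Dependency.mem_bodyVars {τ : Dependency S C} {x : ℕ} :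
    x ∈ τ.bodyVars ↔ x ∈ τ.body.vars := by
  simp [bodyVars]

theorem Conj.sat_congr {γ : Conj S C} {I : Set (Fact S C)} {σ σ' : ℕ → C}
    (h : ∀ x ∈ γ.vars, σ x = σ' x) : γ.Sat I σ ↔ γ.Sat I σ' := by
  have hatom : ∀ a ∈ γ.atoms, a.inst σ = a.inst σ' := fun a ha => by
    refine congrArg (Fact.mk a.pred) (funext fun i => ?_)
    rcases hi : a.args i with x | c
    · exact h x (Or.inl ⟨a, ha, i, hi⟩)
    · rfl
  have hineq : ∀ e ∈ γ.ineqs, e.1.val σ = e.1.val σ' ∧ e.2.val σ = e.2.val σ' := fun e he => by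
    constructor
    · rcases hi : e.1 with x | c
      · exact h x (Or.inr ⟨e, he, Or.inl hi⟩)
      · rfl
    · rcases hi : e.2 with x | c
      · exact h x (Or.inr ⟨e, he, Or.inr hi⟩)
      · rfl
  exact and_congr (forall₂_congr fun a ha => by rw [hatom a ha])
    (forall₂_congr fun e he => by rw [(hineq e he).1, (hineq e he).2])

open scoped Classical in
/-- The number of the value of a term, if the values of the variables are given by numbers. -/
noncomputable def Tm.num (cs : List C) (s : ℕ → ℕ) : Tm C → ℕ
  | .var x => s x
  | .cst c => cs.idxOf c

/-- The conjunction holds, for an interpretation of the predicates by relations between numbers of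
constants. -/
def Conj.NumSat (cs : List C) (M : ∀ p : S.Pred, (Fin (S.arity p) → ℕ) → Prop) (s : ℕ → ℕ)
    (γ : Conj S C) : Prop :=
  (∀ a ∈ γ.atoms, M a.pred fun i => (a.args i).num cs s) ∧
    ∀ e ∈ γ.ineqs, ¬ e.1.num cs s = e.2.num cs s

def Dependency.NumSat (cs : List C) (M : ∀ p : S.Pred, (Fin (S.arity p) → ℕ) → Prop) (N : ℕ)
    (s₀ : ℕ → ℕ) (τ : Dependency S C) : Prop :=
  ∀ s, Variant τ.bodyVars N s₀ s → τ.body.NumSat cs M s →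
    ∃ q ∈ τ.head, ∃ s', Variant q.ex N s s' ∧ q.conj.NumSat cs M s'

theorem Conj.mem_constList_atom {γ : Conj S C} {a : Atom S C} (ha : a ∈ γ.atoms)
    {i : Fin (S.arity a.pred)} {c : C} (hi : a.args i = .cst c) : c ∈ γ.constList := by
  refine List.mem_append_left _ (List.mem_flatMap.2 ⟨a, ha, List.mem_flatMap.2 ⟨a.args i, ?_, ?_⟩⟩)
  · exact List.mem_ofFn.2 ⟨i, rfl⟩
  · rw [hi]; exact List.mem_singleton_self c

theorem Conj.mem_constList_ineq {γ : Conj S C} {e : Tm C × Tm C} (he : e ∈ γ.ineqs) {c : C}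
    (hc : e.1 = .cst c ∨ e.2 = .cst c) : c ∈ γ.constList := by
  refine List.mem_append_right _ (List.mem_flatMap.2 ⟨e, he, List.mem_append.2 ?_⟩)
  rcases hc with h | h
  · rw [h]; exact Or.inl (List.mem_singleton_self c)
  · rw [h]; exact Or.inr (List.mem_singleton_self c)

variable {cs dom : List C} (c₀ : C)

theorem getD_injOn (hdom : dom.Nodup) {i j : ℕ} (hi : i < dom.length) (hj : j < dom.length)
    (h : dom.getD i c₀ = dom.getD j c₀) : i = j := by
  rw [List.getD_eq_getElem _ _ hi, List.getD_eq_getElem _ _ hj] at h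
  exact (List.Nodup.getElem_inj_iff hdom).1 h

theorem exists_getD_eq {c : C} (h : c ∈ dom) : ∃ i < dom.length, dom.getD i c₀ = c := by
  obtain ⟨i, hi, he⟩ := List.getElem_of_mem h
  exact ⟨i, hi, by rw [List.getD_eq_getElem _ _ hi, he]⟩

theorem Tm.num_lt (hcs : cs <+: dom) {s : ℕ → ℕ} {t : Tm C}
    (hvar : ∀ x, t = .var x → s x < dom.length) (hc : ∀ c, t = .cst c → c ∈ cs) :
    t.num cs s < dom.length := by
  classical
  rcases t with x | c
  · exact hvar x rfl
  · exact (List.idxOf_lt_length_iff.2 (hc c rfl)).trans_le hcs.length_le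

theorem Tm.getD_num (hcs : cs <+: dom) {s : ℕ → ℕ} {t : Tm C} (hc : ∀ c, t = .cst c → c ∈ cs) :
    dom.getD (t.num cs s) c₀ = t.val fun x => dom.getD (s x) c₀ := by
  classical
  rcases t with x | c
  · rfl
  · obtain ⟨l, rfl⟩ := hcs
    have hlt := List.idxOf_lt_length_iff.2 (hc c rfl)
    have : (cs ++ l).getD (cs.idxOf c) c₀ = c := by
      rw [List.getD_append _ _ _ _ hlt, List.getD_eq_getElem _ _ hlt, List.getElem_idxOf]
    exact this

theorem Conj.numSat_iff (hdom : dom.Nodup) (hcs : cs <+: dom) {γ : Conj S C}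
    (hγ : ∀ c ∈ γ.constList, c ∈ cs) {M : ∀ p : S.Pred, (Fin (S.arity p) → ℕ) → Prop}
    {I : Set (Fact S C)} (hM : ∀ p t, (∀ i, t i < dom.length) →
      (M p t ↔ Fact.mk p (fun i => dom.getD (t i) c₀) ∈ I))
    {s : ℕ → ℕ} (hs : ∀ x ∈ γ.vars, s x < dom.length) :
    γ.NumSat cs M s ↔ γ.Sat I fun x => dom.getD (s x) c₀ := by
  refine and_congr (forall₂_congr fun a ha => ?_) (forall₂_congr fun e he => ?_)
  · have h₁ : ∀ i c, a.args i = .cst c → c ∈ cs := fun i c hi => hγ c (mem_constList_atom ha hi)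
    rw [hM _ _ fun i => Tm.num_lt hcs (fun x hx => hs x (Or.inl ⟨a, ha, i, hx⟩)) (h₁ i)]
    simp only [Tm.getD_num c₀ hcs (h₁ _)]
    rfl
  · have h₁ : ∀ c, e.1 = .cst c → c ∈ cs := fun c hc => hγ c (mem_constList_ineq he (Or.inl hc))
    have h₂ : ∀ c, e.2 = .cst c → c ∈ cs := fun c hc => hγ c (mem_constList_ineq he (Or.inr hc))
    refine not_congr ?_
    rw [← Tm.getD_num c₀ hcs h₁, ← Tm.getD_num c₀ hcs h₂]
    refine ⟨congrArg fun i => dom.getD i c₀, getD_injOn c₀ hdom ?_ ?_⟩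
    · exact Tm.num_lt hcs (fun x hx => hs x (Or.inr ⟨e, he, Or.inl hx⟩)) h₁
    · exact Tm.num_lt hcs (fun x hx => hs x (Or.inr ⟨e, he, Or.inr hx⟩)) h₂

theorem Conj.Sat.mem_dom {γ : Conj S C} {I : Set (Fact S C)} {σ : ℕ → C} (h : γ.Sat I σ)
    (hI : ∀ f ∈ I, ∀ i, f.args i ∈ dom) {x : ℕ} (hx : x ∈ γ.predVars) : σ x ∈ dom := by
  obtain ⟨a, ha, i, hi⟩ := hx
  have : (a.args i).val σ ∈ dom := hI _ (h.1 a ha) i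
  rwa [hi] at this

/-- Dependencies are domain independent. -/
theorem Dependency.numSat_iff (hdom : dom.Nodup) (hcs : cs <+: dom) {τ : Dependency S C}
    (hτ : ∀ c ∈ τ.constList, c ∈ cs) {M : ∀ p : S.Pred, (Fin (S.arity p) → ℕ) → Prop}
    {I : Set (Fact S C)} (hI : ∀ f ∈ I, ∀ i, f.args i ∈ dom)
    (hM : ∀ p t, (∀ i, t i < dom.length) →
      (M p t ↔ Fact.mk p (fun i => dom.getD (t i) c₀) ∈ I)) (s₀ : ℕ → ℕ) :
    τ.NumSat cs M dom.length s₀ ↔ τ.Sat I := by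
  have hbody : ∀ c ∈ τ.body.constList, c ∈ cs := fun c hc => hτ c (List.mem_append_left _ hc)
  have hhead : ∀ q ∈ τ.head, ∀ c ∈ q.conj.constList, c ∈ cs := fun q hq c hc =>
    hτ c (List.mem_append_right _ (List.mem_flatMap.2 ⟨q, hq, hc⟩))
  have hlt : ∀ q ∈ τ.head, ∀ {s s' : ℕ → ℕ}, Variant τ.bodyVars dom.length s₀ s →
      Variant q.ex dom.length s s' → ∀ x ∈ q.conj.vars, s' x < dom.length := by
    intro q hq s s' hs hs' x hx
    by_cases hex : x ∈ q.ex
    · exact hs'.1 x hex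
    · rw [hs'.2 x hex]
      exact hs.1 x (mem_bodyVars.2 (τ.head_free q hq ⟨hx, hex⟩))
  constructor
  · intro h σ hσ
    have hex : ∀ x, ∃ i, x ∈ τ.bodyVars → i < dom.length ∧ dom.getD i c₀ = σ x := fun x => by
      by_cases hx : x ∈ τ.bodyVars
      · obtain ⟨i, hi⟩ := exists_getD_eq c₀
          (hσ.mem_dom hI (τ.body_safe (mem_bodyVars.1 hx)))
        exact ⟨i, fun _ => hi⟩
      · exact ⟨0, fun h => (hx h).elim⟩
    choose idx hidx using hex
    let s : ℕ → ℕ := fun x => if x ∈ τ.bodyVars then idx x else s₀ x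
    have hs : Variant τ.bodyVars dom.length s₀ s :=
      ⟨fun x hx => by simpa [s, hx] using (hidx x hx).1, fun x hx => by simp [s, hx]⟩
    have hsσ : ∀ x ∈ τ.body.vars, dom.getD (s x) c₀ = σ x := fun x hx => by
      have hx' := mem_bodyVars.2 hx
      simpa only [s, if_pos hx'] using (hidx x hx').2
    obtain ⟨q, hq, s', hs', hsat⟩ := h s hs <|
      (Conj.numSat_iff c₀ hdom hcs hbody hM fun x hx => hs.1 x (mem_bodyVars.2 hx)).2
        ((Conj.sat_congr hsσ).2 hσ)
    refine ⟨q, hq, fun x => if x ∈ q.ex then dom.getD (s' x) c₀ else σ x,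
      fun x hx => by simp [hx], ?_⟩
    refine (Conj.sat_congr fun x hx => ?_).1
      ((Conj.numSat_iff c₀ hdom hcs (hhead q hq) hM (hlt q hq hs hs')).1 hsat)
    by_cases hex : x ∈ q.ex
    · simp [hex]
    · rw [if_neg hex, hs'.2 x hex]
      exact hsσ x (τ.head_free q hq ⟨hx, hex⟩)
  · intro h s hs hsat
    obtain ⟨q, hq, σ', hσ', hsat'⟩ := h _ <|
      (Conj.numSat_iff c₀ hdom hcs hbody hM fun x hx => hs.1 x (mem_bodyVars.2 hx)).1 hsat
    have hex : ∀ x, ∃ i, x ∈ q.ex → i < dom.length ∧ dom.getD i c₀ = σ' x := fun x => by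
      by_cases hx : x ∈ q.ex
      · obtain ⟨i, hi⟩ := exists_getD_eq c₀ (hsat'.mem_dom hI (τ.head_safe q hq hx))
        exact ⟨i, fun _ => hi⟩
      · exact ⟨0, fun h => (hx h).elim⟩
    choose idx hidx using hex
    let s' : ℕ → ℕ := fun x => if x ∈ q.ex then idx x else s x
    have hs' : Variant q.ex dom.length s s' :=
      ⟨fun x hx => by simpa [s', hx] using (hidx x hx).1, fun x hx => by simp [s', hx]⟩
    refine ⟨q, hq, s', hs', ?_⟩
    refine (Conj.numSat_iff c₀ hdom hcs (hhead q hq) hM (hlt q hq hs hs')).2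
      ((Conj.sat_congr fun x _ => ?_).1 hsat')
    by_cases hx : x ∈ q.ex
    · simpa only [s', if_pos hx] using (hidx x hx).2.symm
    · simpa only [s', if_neg hx] using hσ' x hx

end Numbers

section RepairBits

variable {S : Sig.{u}} {C : Type v} (Sg : Finset (Dependency S C))

/-- The relations of the second database together with the tuple `y` in the relation of `p`. -/
def AuxBitInsert (w : List Bool) (N : ℕ) (p : S.Pred) (y : ℕ → ℕ) (p' : S.Pred)
    (t : Fin (S.arity p') → ℕ) : Prop :=
  AuxBit Sg w N p' t ∨ p' = p ∧ ∀ i : Fin (S.arity p'), t i = y i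

/-- The second database of the encoded pair is a repair for the first one. -/
def RepairBits (w : List Bool) (N : ℕ) (y₀ s₀ : ℕ → ℕ) : Prop :=
  (∀ p ∈ dataPreds Sg, ∀ y, Variant (Finset.range (S.arity p)) N y₀ y →
    AuxBit Sg w N p (fun i => y i) → MainBit Sg w N p fun i => y i) ∧
  (∀ τ ∈ Sg.toList, τ.NumSat (consts Sg) (AuxBit Sg w N) N s₀) ∧
  ∀ p ∈ dataPreds Sg, ∀ y, Variant (Finset.range (S.arity p)) N y₀ y →
    MainBit Sg w N p (fun i => y i) → ¬ AuxBit Sg w N p (fun i => y i) →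
      ∃ τ ∈ Sg.toList, ¬ τ.NumSat (consts Sg) (AuxBitInsert Sg w N p y) N s₀

variable {Sg}

theorem mem_consts_of_mem {τ : Dependency S C} (hτ : τ ∈ Sg) {c : C} (hc : c ∈ τ.constList) :
    c ∈ consts Sg := by
  classical
  exact List.mem_dedup.2 (List.mem_flatMap.2 ⟨τ, Finset.mem_toList.2 hτ, hc⟩)

variable {dom : List C} {D D' : Set (Fact S C)}

theorem IsInstance.mainBit_iff_getD (h : IsInstance Sg dom D D') (c₀ : C) (p : S.Pred)
    (t : Fin (S.arity p) → ℕ) (ht : ∀ i, t i < dom.length) :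
    MainBit Sg (encode Sg dom D D') dom.length p t ↔
      Fact.mk p (fun i => dom.getD (t i) c₀) ∈ D := by
  refine (h.mainBit_iff fun i => ⟨t i, ht i⟩).trans ?_
  simp only [List.getD_eq_getElem _ _ (ht _), List.get_eq_getElem]

theorem IsInstance.auxBit_iff_getD (h : IsInstance Sg dom D D') (c₀ : C) (p : S.Pred)
    (t : Fin (S.arity p) → ℕ) (ht : ∀ i, t i < dom.length) :
    AuxBit Sg (encode Sg dom D D') dom.length p t ↔
      Fact.mk p (fun i => dom.getD (t i) c₀) ∈ D' := by
  refine (h.auxBit_iff fun i => ⟨t i, ht i⟩).trans ?_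
  simp only [List.getD_eq_getElem _ _ (ht _), List.get_eq_getElem]

theorem forall_tuple_iff (c₀ : C) {E : Set (Fact S C)}
    (hE : ∀ f ∈ E, f.pred ∈ dataPreds Sg ∧ ∀ i, f.args i ∈ dom) (y₀ : ℕ → ℕ)
    (P : Fact S C → Prop) :
    (∀ f ∈ E, P f) ↔ ∀ p ∈ dataPreds Sg, ∀ y : ℕ → ℕ,
      Variant (Finset.range (S.arity p)) dom.length y₀ y →
      Fact.mk p (fun i : Fin (S.arity p) => dom.getD (y i) c₀) ∈ E →
        P ⟨p, fun i => dom.getD (y i) c₀⟩ := by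
  constructor
  · exact fun h p _ y _ hf => h _ hf
  · rintro h ⟨p, x⟩ hf
    obtain ⟨hp, hx⟩ := hE _ hf
    choose t ht₁ ht₂ using fun i => exists_getD_eq c₀ (hx i)
    have := h p hp (fun j => if hj : j < S.arity p then t ⟨j, hj⟩ else y₀ j)
      ⟨fun j hj => by simpa [Finset.mem_range.1 hj] using ht₁ ⟨j, Finset.mem_range.1 hj⟩,
        fun j hj => dif_neg fun h₁ => hj (Finset.mem_range.2 h₁)⟩
    simp only [Fin.is_lt, dite_true, Fin.eta, ht₂] at this
    exact this hf

theorem IsInstance.isRepair_iff [Nonempty C] (hSg : Acyclic Sg) (h : IsInstance Sg dom D D')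
    (y₀ s₀ : ℕ → ℕ) :
    IsRepair Sg D D' ↔ RepairBits Sg (encode Sg dom D D') dom.length y₀ s₀ := by
  obtain ⟨c₀⟩ := ‹Nonempty C›
  have : Nonempty C := ⟨c₀⟩
  have hD : ∀ f ∈ D, f.pred ∈ dataPreds Sg ∧ ∀ i, f.args i ∈ dom := fun f hf =>
    ⟨(isDatabaseOver_iff Sg).1 h.database f hf, h.adom f (Or.inl hf)⟩
  have hD' : ∀ f ∈ D', f.pred ∈ dataPreds Sg ∧ ∀ i, f.args i ∈ dom := fun f hf =>
    ⟨(isDatabaseOver_iff Sg).1 h.database' f hf, h.adom f (Or.inr hf)⟩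
  have hlt : ∀ {p : S.Pred} {y : ℕ → ℕ}, Variant (Finset.range (S.arity p)) dom.length y₀ y →
      ∀ i : Fin (S.arity p), y i < dom.length := fun hy i => hy.1 i (Finset.mem_range.2 i.2)
  rw [isRepair_iff_subset hSg, RepairBits]
  refine and_congr ?_ (and_congr ?_ ?_)
  · refine (forall_tuple_iff c₀ hD' y₀ (· ∈ D)).trans ?_
    refine forall₂_congr fun p _ => forall₂_congr fun y hy => ?_
    rw [h.auxBit_iff_getD c₀ p _ (hlt hy), h.mainBit_iff_getD c₀ p _ (hlt hy)]
  · rw [consistent_iff]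
    simp only [Finset.mem_toList]
    exact forall₂_congr fun τ hτ => (Dependency.numSat_iff c₀ h.nodup h.consts_prefix
      (fun c hc => mem_consts_of_mem hτ hc) (fun f hf => (hD' f hf).2)
      (h.auxBit_iff_getD c₀) s₀).symm
  · have e₁ : (∀ α ∈ D \ D', ¬ Consistent Sg (insert α D')) ↔
        ∀ α ∈ D, α ∉ D' → ¬ Consistent Sg (insert α D') :=
      ⟨fun H α h₁ h₂ => H α ⟨h₁, h₂⟩, fun H α hα => H α hα.1 hα.2⟩
    refine e₁.trans ((forall_tuple_iff c₀ hD y₀ fun α => α ∉ D' →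
      ¬ Consistent Sg (insert α D')).trans ?_)
    refine forall₂_congr fun p _ => forall₂_congr fun y hy => ?_
    rw [h.auxBit_iff_getD c₀ p _ (hlt hy), h.mainBit_iff_getD c₀ p _ (hlt hy)]
    refine forall_congr' fun hfD => forall_congr' fun _ => ?_
    rw [consistent_iff]
    push Not
    simp only [Finset.mem_toList]
    refine exists_congr fun τ => and_congr_right fun hτ => not_congr ?_
    refine (Dependency.numSat_iff c₀ h.nodup h.consts_prefix
      (fun c hc => mem_consts_of_mem hτ hc) ?_ (fun p' t ht => ?_) s₀).symm
    · rintro f (rfl | hf)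
      · exact (hD _ hfD).2
      · exact (hD' f hf).2
    · rw [AuxBitInsert, h.auxBit_iff_getD c₀ p' t ht, Set.mem_insert_iff, or_comm]
      refine or_congr ⟨?_, fun e => ?_⟩ Iff.rfl
      · rintro ⟨rfl, e⟩
        simp only [e]
      · obtain rfl : p' = p := congrArg Fact.pred e
        exact ⟨rfl, fun i => getD_injOn c₀ h.nodup (ht i) (hlt hy i)
          (congrFun (eq_of_heq (Fact.mk.inj e).2) i)⟩

/-! ### Definability of repair checking -/

theorem ExprDef.offset (p : S.Pred) (ps : List S.Pred) :
    ExprDef fun _ N _ _ => offset p N ps := by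
  classical
  induction ps with
  | nil => exact .const 0
  | cons q ps ih =>
    by_cases h : q = p
    · simpa only [CQA.offset, if_pos h] using .const 0
    · simpa only [CQA.offset, if_neg h] using (ExprDef.base.pow _).add ih

theorem ExprDef.relLen (ps : List S.Pred) : ExprDef fun _ N _ _ => relLen ps N := by
  induction ps with
  | nil => exact .const 0
  | cons q ps ih => exact (ExprDef.base.pow _).add ih

theorem ExprDef.tupleCode {a : ℕ} {t : Fin a → ℕ → ℕ → (ℕ → ℕ) → (ℕ → ℕ) → ℕ}
    (ht : ∀ i, ExprDef (t i)) : ExprDef fun n N y s => tupleCode N fun i => t i n N y s :=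
  .sum Finset.univ fun i => (ht i).mul (ExprDef.base.pow i)

theorem ExprDef.num (cs : List C) (t : Tm C) : ExprDef fun _ _ _ s => t.num cs s := by
  cases t with
  | var x => exact .even x
  | cst c => exact .const _

variable {k : ℕ}

theorem Definable.mainBit (p : S.Pred)
    {t : Fin (S.arity p) → ℕ → ℕ → (ℕ → ℕ) → (ℕ → ℕ) → ℕ} (ht : ∀ i, ExprDef (t i)) :
    Definable k fun w N y s => MainBit Sg w N p fun i => t i w.length N y s :=
  (Definable.const (p ∈ dataPreds Sg)).and (.bit ((ExprDef.offset p _).add (.tupleCode ht)))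

theorem Definable.auxBit (p : S.Pred)
    {t : Fin (S.arity p) → ℕ → ℕ → (ℕ → ℕ) → (ℕ → ℕ) → ℕ} (ht : ∀ i, ExprDef (t i)) :
    Definable k fun w N y s => AuxBit Sg w N p fun i => t i w.length N y s :=
  (Definable.const (p ∈ dataPreds Sg)).and
    (.bit ((ExprDef.relLen _).add ((ExprDef.offset p _).add (.tupleCode ht))))

theorem Definable.auxBitInsert (p p' : S.Pred)
    {t : Fin (S.arity p') → ℕ → ℕ → (ℕ → ℕ) → (ℕ → ℕ) → ℕ} (ht : ∀ i, ExprDef (t i)) :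
    Definable k fun w N y s => AuxBitInsert Sg w N p y p' fun i => t i w.length N y s :=
  (Definable.auxBit p' ht).or ((Definable.const (p' = p)).and
    ((Definable.ball (List.finRange _) fun i _ =>
      Definable.eq (ht i) (.odd i)).congr fun w N y s => by simp))

theorem Definable.conjNumSat {cs : List C}
    {M : List Bool → ℕ → (ℕ → ℕ) → ∀ p : S.Pred, (Fin (S.arity p) → ℕ) → Prop}
    (hM : ∀ p (t : Fin (S.arity p) → ℕ → ℕ → (ℕ → ℕ) → (ℕ → ℕ) → ℕ), (∀ i, ExprDef (t i)) →
      Definable k fun w N y s => M w N y p fun i => t i w.length N y s) (γ : Conj S C) :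
    Definable k fun w N y s => γ.NumSat cs (M w N y) s :=
  (Definable.ball γ.atoms fun a _ => hM a.pred
    (fun i _ _ _ s => (a.args i).num cs s) fun i => .num cs (a.args i)).and
    (Definable.ball γ.ineqs fun e _ => (Definable.eq (.num cs e.1) (.num cs e.2)).not)

theorem Definable.dependencyNumSat {cs : List C}
    {M : List Bool → ℕ → (ℕ → ℕ) → ∀ p : S.Pred, (Fin (S.arity p) → ℕ) → Prop}
    (hM : ∀ p (t : Fin (S.arity p) → ℕ → ℕ → (ℕ → ℕ) → (ℕ → ℕ) → ℕ), (∀ i, ExprDef (t i)) →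
      Definable k fun w N y s => M w N y p fun i => t i w.length N y s) (τ : Dependency S C) :
    Definable k fun w N y s => τ.NumSat cs (M w N y) N s :=
  ((Definable.conjNumSat hM τ.body).imp (Definable.bex τ.head fun q _ =>
    (Definable.conjNumSat hM q.conj).exists_variant_even q.ex)).forall_variant_even τ.bodyVars

theorem Definable.repairBits : Definable k fun w N y s => RepairBits Sg w N y s := by
  have hodd : ∀ {a : ℕ} (i : Fin a), ExprDef fun _ _ y _ => y i := fun i => .odd i
  refine .and (.ball _ fun p _ => .forall_variant_odd (.imp (.auxBit p hodd) (.mainBit p hodd)) _)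
    (.and (.ball _ fun τ _ => .dependencyNumSat (fun p t ht => .auxBit p ht) τ)
      (.ball _ fun p _ => .forall_variant_odd (.imp (.mainBit p hodd)
        (.imp (.not (.auxBit p hodd)) (.bex _ fun τ _ => .not
          (.dependencyNumSat (fun p' t ht => .auxBitInsert p p' ht) τ)))) _))

theorem exists_nodup_extension [Infinite C] {cs : List C} (hcs : cs.Nodup) {N : ℕ}
    (hN : cs.length ≤ N) : ∃ dom : List C, dom.Nodup ∧ cs <+: dom ∧ dom.length = N := by
  classical
  induction N, hN using Nat.le_induction with
  | base => exact ⟨cs, hcs, List.prefix_rfl, rfl⟩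
  | succ N _ ih =>
    obtain ⟨dom, h₁, h₂, h₃⟩ := ih
    obtain ⟨c, hc⟩ := Infinite.exists_notMem_finset dom.toFinset
    rw [List.mem_toFinset] at hc
    refine ⟨dom ++ [c], ?_, h₂.trans (List.prefix_append _ _), by simp [h₃]⟩
    rw [List.nodup_append]
    refine ⟨h₁, List.nodup_singleton c, fun a ha b hb => ?_⟩
    rw [List.mem_singleton.1 hb]
    exact fun e => hc (e ▸ ha)

theorem Definable.exists_dom {cs : List C} (hcs : cs.Nodup) : Definable k fun _ N _ _ =>
    ∃ dom : List C, dom.Nodup ∧ cs <+: dom ∧ dom.length = N := by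
  rcases finite_or_infinite C with hC | hC
  · have := Fintype.ofFinite C
    refine (Definable.bex (List.range (Fintype.card C + 1)) fun m _ =>
      (Definable.const (∃ dom : List C, dom.Nodup ∧ cs <+: dom ∧ dom.length = m)).and
        (.eq .base (.const m))).congr fun w N y s => ?_
    constructor
    · rintro ⟨m, _, h, rfl⟩
      exact h
    · rintro ⟨dom, h₁, h₂, rfl⟩
      exact ⟨dom.length, List.mem_range.2 (Nat.lt_succ_of_le h₁.length_le_card),
        ⟨dom, h₁, h₂, rfl⟩, rfl⟩
  · refine (Definable.not (.lt .base (.const cs.length))).congr fun w N y s => ?_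
    rw [not_lt]
    refine ⟨exists_nodup_extension hcs, ?_⟩
    rintro ⟨dom, _, h₂, rfl⟩
    exact h₂.length_le

theorem mem_repairLanguage_iff [Nonempty C] (hSg : Acyclic Sg) (w : List Bool) (y s : ℕ → ℕ) :
    w ∈ repairLanguage Sg ↔ ∃ N < w.length + (consts Sg).length + 1,
      (∃ dom : List C, dom.Nodup ∧ consts Sg <+: dom ∧ dom.length = N) ∧
        relLen (dataPreds Sg) N + relLen (dataPreds Sg) N = w.length ∧ RepairBits Sg w N y s := by
  constructor
  · rintro ⟨dom, D, D', h, rfl, hrep⟩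
    obtain ⟨dom', h', he, hlt, -⟩ := h.exists_canonical
    refine ⟨dom'.length, hlt, ⟨dom', h'.nodup, h'.consts_prefix, rfl⟩, ?_, ?_⟩
    · rw [← he, length_encode]
    · rw [← he]
      exact (h'.isRepair_iff hSg y s).1 hrep
  · rintro ⟨_, _, ⟨dom, h₁, h₂, rfl⟩, hlen, hrep⟩
    obtain ⟨D, D', h, rfl⟩ := exists_encode_eq Sg dom h₁ w hlen h₂
    exact ⟨dom, D, D', h, rfl, (h.isRepair_iff hSg y s).2 hrep⟩

theorem inAC0_repairLanguage [Nonempty C] (hSg : Acyclic Sg) : InAC0 (repairLanguage Sg) := by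
  obtain ⟨φ, hφ⟩ := ((Definable.exists_dom (k := (consts Sg).length) (nodup_consts Sg)).and
    ((Definable.eq ((ExprDef.relLen (dataPreds Sg)).add (.relLen (dataPreds Sg))) .length).and
      (Definable.repairBits (Sg := Sg)))).exists_base
  have : repairLanguage Sg = {w | φ.Holds (consts Sg).length w fun _ => 0} := by
    ext w
    have h₀ : (fun _ => 0 : ℕ → ℕ) = join 0 (fun _ => 0) fun _ => 0 := by
      funext j
      rcases j with _ | j <;> simp [join]
    refine (mem_repairLanguage_iff hSg w (fun _ => 0) fun _ => 0).trans ?_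
    have := hφ w 0 (fun _ => 0) (fun _ => 0) (Nat.succ_pos _)
    rw [← h₀] at this
    exact this.symm
  rw [this]
  exact φ.inAC0 _

theorem encode_mem_repairLanguage_iff [Nonempty C] (hSg : Acyclic Sg)
    (h : IsInstance Sg dom D D') : encode Sg dom D D' ∈ repairLanguage Sg ↔ IsRepair Sg D D' := by
  refine ⟨?_, fun hrep => ⟨dom, D, D', h, rfl, hrep⟩⟩
  rintro ⟨dom₁, D₁, D₁', h₁, he, hrep⟩
  obtain ⟨dom', h', he', -, huniq⟩ := h.exists_canonical
  obtain ⟨dom₁', h₁', he₁', hlen⟩ := huniq h₁ he.symm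
  have := (h₁'.isRepair_iff hSg (fun _ => 0) fun _ => 0).1 hrep
  rw [he₁', ← he', hlen] at this
  exact (h'.isRepair_iff hSg (fun _ => 0) fun _ => 0).2 this

end RepairBits

end CQA

theorem mainTheorem1 {S : CQA.Sig} {C : Type*} [Nonempty C]
    (Sg : Finset (CQA.Dependency S C)) (hSg : CQA.Acyclic Sg) :
    (∀ D D' : Set (CQA.Fact S C), CQA.IsDatabase D → D' ⊆ D →
      (CQA.IsRepair Sg D D' ↔
        CQA.Consistent Sg D' ∧ ∀ α ∈ D \ D', ¬ CQA.Consistent Sg (insert α D'))) ∧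
    (∀ D D' : Set (CQA.Fact S C), CQA.IsDatabaseOver Sg D → D' ⊆ D →
      (CQA.Models (CQA.withAux D D') (CQA.psiRc Sg) ↔ CQA.IsRepair Sg D D')) ∧
    CQA.RepairCheckingFORewritable Sg ∧
    CQA.InAC0 (CQA.repairLanguage Sg) ∧
    (∀ (dom : List C) (D D' : Set (CQA.Fact S C)), CQA.IsInstance Sg dom D D' →
      (CQA.encode Sg dom D D' ∈ CQA.repairLanguage Sg ↔ CQA.IsRepair Sg D D')) :=
  ⟨fun _ _ _ hsub => CQA.isRepair_iff hSg hsub,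
    fun _ _ hD hsub => (CQA.models_psiRc Sg hD).trans (CQA.isRepair_iff hSg hsub).symm,
    CQA.repairCheckingFORewritable hSg, CQA.inAC0_repairLanguage hSg,
    fun _ _ _ h => CQA.encode_mem_repairLanguage_iff hSg h⟩
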